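/- Let $n$ and $k$ be integers with $1 \le k \le n/2$. Let $\wedge\{\Theta_n,\Xi_n\}$ be the exterior algebra over $\mathbb{C}$ generated by $\theta_1,\dots,\theta_n,\xi_1,\dots,\xi_n$, on which $\mathfrak{S}_n$ acts by algebra automorphisms via $w\cdot\theta_i=\theta_{w(i)}$, $w\cdot\xi_i=\xi_{w(i)}$. For a generator $\omega$ let $\omega\odot(-)$ be the contraction: the linear map with $\omega\odot(\omega_1\cdots\omega_r)=(-1)^{s-1}\,\omega_1\cdots\widehat{\omega_s}\cdots\omega_r$ if $\omega=\omega_s$, and $0$ if $\omega\notin\{\omega_1,\dots,\omega_r\}$, for distinct generators $\omega_1,\dots,\omega_r$; extend this linearly in $\omega$. For nonempty $B\subseteq\{1,\dots,n\}$ define the operator $$\rho_B(f)=\sum_{i,j\in B,\ i\ne j}\xi_i\cdot(\theta_j\odot f)\ \text{ if } |B|>1,\qquad \rho_{\{i\}}(f)=\xi_i\cdot(\theta_i\odot f);$$ these operators commute. For a set partition $\pi=\{B_1/\cdots/B_m\}$ of $\{1,\dots,n\}$ put $$F_\pi=(\rho_{B_1}\circ\cdots\circ\rho_{B_m})(\theta_1\theta_2\cdots\theta_n),\qquad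 f_\pi=(\xi_1+\cdots+\xi_n)\odot F_\pi .$$ Let $W(n,k,0)$ (respectively $V(n,k,0)$) be the $\mathbb{C}$-linear span of the $F_\pi$ (respectively the $f_\pi$), where $\pi$ runs over all set partitions of $\{1,\dots,n\}$ into $k$ blocks, none of which is a singleton. These spans are $\mathfrak{S}_n$-submodules of $\wedge\{\Theta_n,\Xi_n\}$. Let $\lambda=(k,k,1^{n-2k})$ and let $S^\lambda$ be the Specht module over $\mathbb{C}$, the span of the polytabloids of shape $\lambda$ (so that $S^{(n)}$ is the trivial and $S^{(1^n)}$ the sign representation). Then $S^\lambda$ is irreducible, and both $W(n,k,0)$ and $V(n,k,0)$ are isomorphic to $S^\lambda$ as $\mathfrak{S}_n$-modules. -/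

import Mathlib

namespace SkeinFermion

noncomputable section

open Equiv

/-! ### The exterior algebra on `θ_1, …, θ_n, ξ_1, …, ξ_n` -/

/-- The vector space with basis `θ_1, …, θ_n` (indices `Sum.inl i`) and
`ξ_1, …, ξ_n` (indices `Sum.inr i`). -/
abbrev Gen (n : ℕ) : Type := (Fin n ⊕ Fin n) →₀ ℂ

/-- The exterior algebra over `ℂ` generated by `θ_1, …, θ_n, ξ_1, …, ξ_n`. -/
abbrev Ext (n : ℕ) : Type := ExteriorAlgebra ℂ (Gen n)

/-- The generator `ω_a`: `θ_i` for `a = Sum.inl i` and `ξ_i` for `a = Sum.inr i`. -/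
def gen {n : ℕ} (a : Fin n ⊕ Fin n) : Ext n :=
  ExteriorAlgebra.ι ℂ (Finsupp.single a 1)

/-- The variable `θ_i`. -/
def theta {n : ℕ} (i : Fin n) : Ext n := gen (Sum.inl i)

/-- The variable `ξ_i`. -/
def xi {n : ℕ} (i : Fin n) : Ext n := gen (Sum.inr i)

/-- The contraction `f ↦ ω_a ⊙ f`: the linear map that sends a product of distinct generators
`ω_{j_1} ⋯ ω_{j_r}` to `(-1)^(s-1) ω_{j_1} ⋯ (omit ω_{j_s}) ⋯ ω_{j_r}` if `j_s = a`,
and to `0` if `a` is not among the `j`'s. -/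
def contract {n : ℕ} (a : Fin n ⊕ Fin n) : Ext n →ₗ[ℂ] Ext n :=
  CliffordAlgebra.contractLeft (Finsupp.lapply a : Gen n →ₗ[ℂ] ℂ)

/-- The diagonal action of the symmetric group by algebra automorphisms:
`w · θ_i = θ_{w(i)}` and `w · ξ_i = ξ_{w(i)}`. -/
def extRep (n : ℕ) : Representation ℂ (Perm (Fin n)) (Ext n) where
  toFun w := (ExteriorAlgebra.map
    (Finsupp.lmapDomain ℂ ℂ (Sum.map w w) : Gen n →ₗ[ℂ] Gen n)).toLinearMap
  map_one' := by
    have : (Finsupp.lmapDomain ℂ ℂ (Sum.map (1 : Perm (Fin n)) (1 : Perm (Fin n))) :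
        Gen n →ₗ[ℂ] Gen n) = LinearMap.id := by
      ext a : 1
      rcases a with a | a <;> ext <;> simp
    rw [this, ExteriorAlgebra.map_id]
    rfl
  map_mul' v w := by
    have : (Finsupp.lmapDomain ℂ ℂ (Sum.map (v * w : Perm (Fin n)) (v * w : Perm (Fin n))) :
        Gen n →ₗ[ℂ] Gen n) =
        (Finsupp.lmapDomain ℂ ℂ (Sum.map v v)).comp (Finsupp.lmapDomain ℂ ℂ (Sum.map w w)) := by
      ext a : 1
      rcases a with a | a <;> ext <;> simp
    rw [this, ← ExteriorAlgebra.map_comp_map]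
    rfl

theorem extRep_apply {n : ℕ} (w : Perm (Fin n)) (f : Ext n) :
    extRep n w f = ExteriorAlgebra.map
      (Finsupp.lmapDomain ℂ ℂ (Sum.map w w) : Gen n →ₗ[ℂ] Gen n) f := rfl

theorem extRep_mul {n : ℕ} (w : Perm (Fin n)) (f g : Ext n) :
    extRep n w (f * g) = extRep n w f * extRep n w g := by
  simp only [extRep_apply, map_mul]

theorem extRep_gen {n : ℕ} (w : Perm (Fin n)) (a : Fin n ⊕ Fin n) :
    extRep n w (gen a) = gen (Sum.map w w a) := by
  simp [extRep_apply, gen]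

theorem contract_gen_mul {n : ℕ} (a b : Fin n ⊕ Fin n) (f : Ext n) :
    contract a (gen b * f) = (if a = b then f else 0) - gen b * contract a f := by
  have h := CliffordAlgebra.contractLeft_ι_mul (Q := (0 : QuadraticForm ℂ (Gen n)))
    (d := (Finsupp.lapply a : Gen n →ₗ[ℂ] ℂ)) (Finsupp.single b 1) f
  refine h.trans ?_
  congr 1
  by_cases hab : a = b
  · subst hab; simp
  · rw [if_neg hab, Finsupp.lapply_apply, Finsupp.single_eq_of_ne hab, zero_smul]

theorem contract_algebraMap {n : ℕ} (a : Fin n ⊕ Fin n) (r : ℂ) :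
    contract a (algebraMap ℂ (Ext n) r) = 0 :=
  CliffordAlgebra.contractLeft_algebraMap (Q := (0 : QuadraticForm ℂ (Gen n)))
    (d := (Finsupp.lapply a : Gen n →ₗ[ℂ] ℂ)) r

theorem contract_comm {n : ℕ} (a b : Fin n ⊕ Fin n) (f : Ext n) :
    contract a (contract b f) = -contract b (contract a f) :=
  CliffordAlgebra.contractLeft_comm _ _ f

theorem gen_mul_gen {n : ℕ} (a b : Fin n ⊕ Fin n) : (gen a * gen b : Ext n) = -(gen b * gen a) :=
  eq_neg_of_add_eq_zero_left (ExteriorAlgebra.ι_add_mul_swap _ _)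

theorem extRep_contract {n : ℕ} (w : Perm (Fin n)) (a : Fin n ⊕ Fin n) (f : Ext n) :
    extRep n w (contract a f) = contract (Sum.map w w a) (extRep n w f) := by
  induction f using CliffordAlgebra.left_induction with
  | algebraMap r =>
    rw [extRep_apply, extRep_apply]
    have h1 : contract a (algebraMap ℂ (Ext n) r) = 0 := contract_algebraMap _ r
    have h2 : contract (Sum.map w w a) (algebraMap ℂ (Ext n) r) = 0 :=
      contract_algebraMap _ r
    exact (congrArg _ h1).trans ((map_zero _).trans (by
      rw [← h2]
      exact congrArg _ (AlgHom.commutes _ r).symm))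
  | add x y hx hy => simp only [map_add, hx, hy]
  | ι_mul x m hx =>
    induction m using Finsupp.induction_linear with
    | zero => simp
    | add m₁ m₂ h₁ h₂ => simp only [map_add, add_mul, h₁, h₂]
    | single b c =>
      have hb : CliffordAlgebra.ι (0 : QuadraticForm ℂ (Gen n)) (Finsupp.single b c)
          = c • (gen b : Ext n) := by
        rw [gen, ExteriorAlgebra.ι, ← map_smul, Finsupp.smul_single, smul_eq_mul, mul_one]
      have hinj : Function.Injective (Sum.map w w : Fin n ⊕ Fin n → Fin n ⊕ Fin n) :=
        Sum.map_injective.2 ⟨w.injective, w.injective⟩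
      rw [hb, smul_mul_assoc, map_smul, map_smul, map_smul, map_smul, contract_gen_mul,
        extRep_mul, extRep_gen, contract_gen_mul, map_sub, extRep_mul, extRep_gen, hx]
      congr 2
      by_cases hab : a = b
      · subst hab; simp
      · rw [if_neg hab, if_neg (fun h => hab (hinj h)), map_zero]

/-! ### Block operators -/

/-- The operator `f ↦ ξ_i · (θ_j ⊙ f)`. -/
def elemOp {n : ℕ} (i j : Fin n) : Module.End ℂ (Ext n) :=
  (LinearMap.mulLeft ℂ (xi i)).comp (contract (Sum.inl j))

/-- The block operator `ρ_B`: the sum of `f ↦ ξ_i · (θ_j ⊙ f)` over all ordered pairs of distinct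
elements `i, j` of `B`, except that for `B = {i}` it is `f ↦ ξ_i · (θ_i ⊙ f)`. -/
def blockOp {n : ℕ} (B : Finset (Fin n)) : Module.End ℂ (Ext n) :=
  if B.card = 1 then ∑ i ∈ B, elemOp i i else ∑ p ∈ B.offDiag, elemOp p.1 p.2

theorem elemOp_apply {n : ℕ} (i j : Fin n) (f : Ext n) :
    elemOp i j f = gen (Sum.inr i) * contract (Sum.inl j) f := rfl

theorem elemOp_commute {n : ℕ} (a a' b b' : Fin n) :
    Commute (elemOp a a') (elemOp b b') := by
  refine LinearMap.ext fun f => ?_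
  simp only [Module.End.mul_apply, elemOp_apply, contract_gen_mul, reduceCtorEq, if_false,
    zero_sub, mul_neg]
  rw [contract_comm (Sum.inl a'), mul_neg, mul_neg, ← mul_assoc, ← mul_assoc, gen_mul_gen,
    neg_mul, neg_neg]

theorem blockOp_commute {n : ℕ} (A B : Finset (Fin n)) : Commute (blockOp A) (blockOp B) := by
  unfold blockOp
  split_ifs <;>
    exact Commute.sum_left _ _ _ fun _ _ => Commute.sum_right _ _ _ fun _ _ => elemOp_commute _ _ _ _

theorem blockOp_pairwise {n : ℕ} (s : Finset (Finset (Fin n))) :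
    (s : Set (Finset (Fin n))).Pairwise (Function.onFun Commute blockOp) :=
  fun A _ B _ _ => blockOp_commute A B

theorem extRep_elemOp {n : ℕ} (w : Perm (Fin n)) (i j : Fin n) (f : Ext n) :
    extRep n w (elemOp i j f) = elemOp (w i) (w j) (extRep n w f) := by
  simp only [elemOp_apply, extRep_mul, extRep_gen, extRep_contract, Sum.map_inl, Sum.map_inr]

theorem extRep_blockOp {n : ℕ} (w : Perm (Fin n)) (B : Finset (Fin n)) (f : Ext n) :
    extRep n w (blockOp B f) = blockOp (B.map w.toEmbedding) (extRep n w f) := by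
  unfold blockOp
  rw [Finset.card_map]
  split_ifs
  · simp [LinearMap.sum_apply, extRep_elemOp]
  · have : (B.map w.toEmbedding).offDiag =
        B.offDiag.map (w.toEmbedding.prodMap w.toEmbedding) := by
      ext ⟨x, y⟩
      constructor
      · intro h
        obtain ⟨hx, hy, hxy⟩ := Finset.mem_offDiag.1 h
        obtain ⟨a, ha, rfl⟩ := Finset.mem_map.1 hx
        obtain ⟨b, hb, rfl⟩ := Finset.mem_map.1 hy
        exact Finset.mem_map.2 ⟨(a, b), Finset.mem_offDiag.2 ⟨ha, hb, fun h => hxy (congrArg w h)⟩, rfl⟩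
      · intro h
        obtain ⟨⟨a, b⟩, hab, h⟩ := Finset.mem_map.1 h
        obtain ⟨rfl, rfl⟩ := Prod.mk.inj h
        obtain ⟨ha, hb, hab⟩ := Finset.mem_offDiag.1 hab
        exact Finset.mem_offDiag.2 ⟨Finset.mem_map_of_mem _ ha, Finset.mem_map_of_mem _ hb,
          fun h => hab (w.injective h)⟩
    rw [this]
    simp [LinearMap.sum_apply, extRep_elemOp]

/-! ### Set partitions of `[n]` and their fermions -/

/-- Set partitions of `[n]`. -/
abbrev SetPart (n : ℕ) : Type := Finpartition (Finset.univ : Finset (Fin n))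

/-- The number of singleton blocks. -/
def numSingletons {n : ℕ} (π : SetPart n) : ℕ := (π.parts.filter fun B => B.card = 1).card

/-- The composition `ρ_π` of the (commuting) block operators of the blocks of `π`. -/
def rho {n : ℕ} (π : SetPart n) : Module.End ℂ (Ext n) :=
  π.parts.noncommProd blockOp (blockOp_pairwise _)

/-- The product `θ_1 θ_2 ⋯ θ_n`. -/
def thetaTop (n : ℕ) : Ext n := (List.ofFn fun i : Fin n => theta i).prod

/-- The fermion `F_π = ρ_π(θ_1 θ_2 ⋯ θ_n)`. -/
def fermionF {n : ℕ} (π : SetPart n) : Ext n := rho π (thetaTop n)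

/-- The contraction `f ↦ (ξ_1 + ⋯ + ξ_n) ⊙ f`. -/
def xiDeriv (n : ℕ) : Ext n →ₗ[ℂ] Ext n := ∑ i : Fin n, contract (Sum.inr i)

/-- The fermion `f_π = (ξ_1 + ⋯ + ξ_n) ⊙ F_π`. -/
def fermionf {n : ℕ} (π : SetPart n) : Ext n := xiDeriv n (fermionF π)

/-- The image `w(π)` of a set partition under a permutation. -/
def permPart {n : ℕ} (w : Perm (Fin n)) (π : SetPart n) : SetPart n where
  parts := π.parts.map ⟨fun B => B.map w.toEmbedding, Finset.map_injective _⟩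
  supIndep := by
    rw [Finset.supIndep_iff_pairwiseDisjoint]
    intro A hA B hB hAB
    simp only [Finset.coe_map, Function.Embedding.coeFn_mk, Set.mem_image, Finset.mem_coe] at hA hB
    obtain ⟨A, hA, rfl⟩ := hA
    obtain ⟨B, hB, rfl⟩ := hB
    have := π.disjoint hA hB (fun h => hAB (by rw [h]))
    simpa [Function.onFun] using this
  sup_parts := by
    ext x
    obtain ⟨B, hB, hx⟩ := π.exists_mem (Finset.mem_univ (w.symm x))
    simp only [Finset.mem_sup, Finset.mem_univ, iff_true]
    exact ⟨B.map w.toEmbedding, Finset.mem_map_of_mem _ hB,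
      by simpa [Finset.mem_map_equiv] using hx⟩
  bot_notMem := by
    simp only [Finset.mem_map, Function.Embedding.coeFn_mk, Finset.bot_eq_empty,
      Finset.map_eq_empty, exists_eq_right]
    exact π.bot_notMem

theorem card_parts_permPart {n : ℕ} (w : Perm (Fin n)) (π : SetPart n) :
    (permPart w π).parts.card = π.parts.card := by
  simp [permPart]

theorem numSingletons_permPart {n : ℕ} (w : Perm (Fin n)) (π : SetPart n) :
    numSingletons (permPart w π) = numSingletons π := by
  simp [numSingletons, permPart, Finset.filter_map]

theorem extRep_thetaTop {n : ℕ} (w : Perm (Fin n)) :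
    extRep n w (thetaTop n) = (Perm.sign w : ℤ) • thetaTop n := by
  have h : thetaTop n = ExteriorAlgebra.ιMulti ℂ n
      (fun i : Fin n => (Finsupp.single (Sum.inl i) 1 : Gen n)) := by
    rw [ExteriorAlgebra.ιMulti_apply]; rfl
  rw [h, extRep_apply, ExteriorAlgebra.map_apply_ιMulti]
  have h2 := (ExteriorAlgebra.ιMulti ℂ n (M := Gen n)).map_perm
    (fun i : Fin n => (Finsupp.single (Sum.inl i) 1 : Gen n)) w
  rw [← Units.smul_def, ← h2]
  congr 1
  funext i
  simp

theorem noncommProd_blockOp_cons {n : ℕ} (A : Finset (Fin n)) (s : Finset (Finset (Fin n)))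
    (hA : A ∉ s) : (Finset.cons A s hA).noncommProd blockOp (blockOp_pairwise _) =
      blockOp A * s.noncommProd blockOp (blockOp_pairwise _) :=
  Finset.noncommProd_cons s A blockOp hA (blockOp_pairwise _)

theorem extRep_rho {n : ℕ} (w : Perm (Fin n)) (π : SetPart n) (f : Ext n) :
    extRep n w (rho π f) = rho (permPart w π) (extRep n w f) := by
  have key : ∀ (s t : Finset (Finset (Fin n))) (f : Ext n),
      t = s.map ⟨fun B => B.map w.toEmbedding, Finset.map_injective _⟩ →
      extRep n w (s.noncommProd blockOp (blockOp_pairwise _) f) =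
      t.noncommProd blockOp (blockOp_pairwise _) (extRep n w f) := by
    intro s
    induction s using Finset.cons_induction with
    | empty => rintro _ f rfl; rfl
    | cons A s hA ih =>
      intro t f ht
      rw [Finset.map_cons] at ht
      subst ht
      rw [noncommProd_blockOp_cons, noncommProd_blockOp_cons, Module.End.mul_apply,
        Module.End.mul_apply, extRep_blockOp, ih _ _ rfl]
      rfl
  exact key _ _ _ rfl

theorem extRep_fermionF {n : ℕ} (w : Perm (Fin n)) (π : SetPart n) :
    extRep n w (fermionF π) = (Perm.sign w : ℤ) • fermionF (permPart w π) := by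
  rw [fermionF, extRep_rho, extRep_thetaTop, map_zsmul]; rfl

theorem extRep_xiDeriv {n : ℕ} (w : Perm (Fin n)) (f : Ext n) :
    extRep n w (xiDeriv n f) = xiDeriv n (extRep n w f) := by
  simp only [xiDeriv, LinearMap.sum_apply, map_sum, extRep_contract, Sum.map_inr]
  exact Equiv.sum_comp w fun i => contract (Sum.inr i) (extRep n w f)

theorem extRep_fermionf {n : ℕ} (w : Perm (Fin n)) (π : SetPart n) :
    extRep n w (fermionf π) = (Perm.sign w : ℤ) • fermionf (permPart w π) := by
  rw [fermionf, extRep_xiDeriv, extRep_fermionF, map_zsmul]; rfl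

/-- `Π(n,k,m)`: the set partitions of `[n]` with `k` blocks, `m` of which are singletons. -/
def partSet (n k m : ℕ) : Set (SetPart n) := {π | π.parts.card = k ∧ numSingletons π = m}

theorem span_stable {n k m : ℕ} (F : SetPart n → Ext n)
    (hF : ∀ w π, extRep n w (F π) = (Perm.sign w : ℤ) • F (permPart w π))
    (w : Perm (Fin n)) ⦃x : Ext n⦄ (hx : x ∈ Submodule.span ℂ (F '' partSet n k m)) :
    extRep n w x ∈ Submodule.span ℂ (F '' partSet n k m) := by
  induction hx using Submodule.span_induction with
  | mem x hx =>
    obtain ⟨π, ⟨h1, h2⟩, rfl⟩ := hx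
    rw [hF]
    have hπ : permPart w π ∈ partSet n k m :=
      ⟨(card_parts_permPart w π).trans h1, (numSingletons_permPart w π).trans h2⟩
    exact zsmul_mem (Submodule.subset_span (Set.mem_image_of_mem F hπ)) _
  | zero => rw [map_zero]; exact zero_mem _
  | add x y _ _ hx hy => rw [map_add]; exact add_mem hx hy
  | smul c x _ hx => rw [map_smul]; exact Submodule.smul_mem _ c hx

/-- The `𝔖_n`-module `W(n,k,m) = span {F_π : π ∈ Π(n,k,m)}`. -/
def W (n k m : ℕ) : Subrepresentation (extRep n) where
  toSubmodule := Submodule.span ℂ (fermionF '' partSet n k m)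
  apply_mem_toSubmodule w := span_stable fermionF extRep_fermionF w

/-- The `𝔖_n`-module `V(n,k,m) = span {f_π : π ∈ Π(n,k,m)}`. -/
def V (n k m : ℕ) : Subrepresentation (extRep n) where
  toSubmodule := Submodule.span ℂ (fermionf '' partSet n k m)
  apply_mem_toSubmodule w := span_stable fermionf extRep_fermionf w

/-! ### Specht modules -/

/-- Functions `r : [n] → ℕ`, recording a row number for each entry, permuted by `𝔖_n` through
`w · r = r ∘ w⁻¹`, and the resulting permutation representation. A tabloid (a tableau up to
reordering within rows) is encoded as the function sending each entry to its row. -/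
def tabloidRep (n : ℕ) : Representation ℂ (Perm (Fin n)) ((Fin n → ℕ) →₀ ℂ) where
  toFun w := Finsupp.lmapDomain ℂ ℂ fun r => r ∘ (w⁻¹ : Perm (Fin n))
  map_one' := by ext; simp
  map_mul' v w := by
    refine Finsupp.lhom_ext fun r c => ?_
    simp [Function.comp_assoc]

/-- Young tableaux of shape `μ`, as bijections from the entries `[n]` to the cells of `μ`. -/
abbrev Tableau (n : ℕ) (μ : YoungDiagram) : Type := Fin n ≃ {c : ℕ × ℕ // c ∈ μ}

/-- The tabloid of a tableau. -/
def tabloid {n : ℕ} {μ : YoungDiagram} (T : Tableau n μ) : Fin n → ℕ := fun a => (T a).1.1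

/-- The column group of a tableau: the permutations preserving the column of every entry. -/
def colGroup {n : ℕ} {μ : YoungDiagram} (T : Tableau n μ) : Set (Perm (Fin n)) :=
  {σ | ∀ a, (T (σ a)).1.2 = (T a).1.2}

open Classical in
/-- The polytabloid `e_T = ∑_σ sign(σ) · σ{T}`, over the column group of `T`. -/
def polytabloid {n : ℕ} {μ : YoungDiagram} (T : Tableau n μ) : (Fin n → ℕ) →₀ ℂ :=
  ∑ σ : Perm (Fin n) with σ ∈ colGroup T,
    ((Perm.sign σ : ℤ) : ℂ) • tabloidRep n σ (Finsupp.single (tabloid T) 1)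

/-- The tableau `w T`, in which the entry `w a` stands where `a` stands in `T`. -/
def permTableau {n : ℕ} {μ : YoungDiagram} (w : Perm (Fin n)) (T : Tableau n μ) : Tableau n μ :=
  w.symm.trans T

theorem tabloidRep_polytabloid {n : ℕ} {μ : YoungDiagram} (w : Perm (Fin n)) (T : Tableau n μ) :
    tabloidRep n w (polytabloid T) = polytabloid (permTableau w T) := by
  classical
  have h0 : tabloidRep n w (Finsupp.single (tabloid T) 1) =
      Finsupp.single (tabloid (permTableau w T)) 1 := by
    simp only [tabloidRep, MonoidHom.coe_mk, OneHom.coe_mk, Finsupp.lmapDomain_apply,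
      Finsupp.mapDomain_single]
    rfl
  rw [polytabloid, polytabloid, map_sum]
  refine Finset.sum_bij (fun σ _ => w * σ * w⁻¹) ?_ ?_ ?_ ?_
  · intro σ hσ
    simp only [Finset.mem_filter, Finset.mem_univ, true_and] at hσ ⊢
    intro a
    have := hσ (w.symm a)
    simpa [permTableau, Perm.mul_apply] using this
  · intro σ _ τ _ h
    simpa using h
  · intro τ hτ
    simp only [Finset.mem_filter, Finset.mem_univ, true_and] at hτ
    refine ⟨w⁻¹ * τ * w, ?_, by group⟩
    simp only [Finset.mem_filter, Finset.mem_univ, true_and]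
    intro a
    have := hτ (w a)
    simpa [permTableau, Perm.mul_apply] using this
  · intro σ _
    rw [map_smul, ← h0, ← Module.End.mul_apply, ← Module.End.mul_apply, ← map_mul, ← map_mul]
    simp only [inv_mul_cancel_right, map_mul, Perm.sign_inv]
    congr 3
    rw [mul_right_comm, Int.units_mul_self, one_mul]

/-- The Specht module `S^μ` for `𝔖_n`, where `μ` is a Young diagram with `n` cells: the span of all
polytabloids of shape `μ`. -/
def specht (n : ℕ) (μ : YoungDiagram) : Subrepresentation (tabloidRep n) where
  toSubmodule := Submodule.span ℂ (Set.range fun T : Tableau n μ => polytabloid T)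
  apply_mem_toSubmodule w x hx := by
    induction hx using Submodule.span_induction with
    | mem x hx =>
      obtain ⟨T, rfl⟩ := hx
      exact Submodule.subset_span ⟨permTableau w T, (tabloidRep_polytabloid w T).symm⟩
    | zero => rw [map_zero]; exact zero_mem _
    | add x y _ _ hx hy => rw [map_add]; exact add_mem hx hy
    | smul c x _ hx => rw [map_smul]; exact Submodule.smul_mem _ c hx

/-- The flag-shaped Young diagram `(k, k, 1^{n-2k})`, for `1 ≤ k ≤ n/2`. -/
def flagShape (n k : ℕ) (hk : 1 ≤ k) : YoungDiagram :=
  YoungDiagram.ofRowLens (k :: k :: List.replicate (n - 2 * k) 1) (by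
    rw [List.sortedGE_iff_pairwise]
    simp [List.pairwise_cons, List.mem_replicate, List.pairwise_replicate, hk])

end

end SkeinFermion

namespace SkeinFermion

noncomputable section

open Equiv

/-! ### Column antisymmetrizers and irreducibility of Specht modules -/

/-! Everything rests on one explicit equivariant map, `tabloidMap`, from the space of row functions
to the exterior algebra. On a tabloid of flag shape it yields, up to a nonzero scalar, the product
of the `θ_a ξ_a` over the entries of row `0` and of the `θ`'s of the leg. The same element arises
from `θ_1 ⋯ θ_n` when, in each column, the operator `ξ_a · (θ_b ⊙ -)` acts, with `a` above `b` the
two upper entries (`topMonomial_eq_smul`). Permuting `θ_1 ⋯ θ_n` costs a sign, and this sign cancels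
the one in the column antisymmetrizer. A polytabloid therefore goes to an unsigned sum over choices
of an ordered pair in each column, that is, to a nonzero multiple of the fermion of the partition
into columns (`tabloidMap_polytabloid`).

The Specht module thus maps onto the span of the `F_π` for which `π` has one block of size `n - 2k +
2` and `k - 1` pairs. A skein relation (`offDiagSum_mul_offDiagSum`), a consequence of the exchange
rule `opE_mul_opE`, rewrites the fermion of any partition without singletons in terms of these, so
the image is all of `W(n,k,0)` (`span_fermionF_partSet`). Applying the equivariant operator
`xiDeriv` gives `V(n,k,0)`.

Injectivity follows from irreducibility. By the submodule theorem (`specht_le_of_stable`), an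
equivariant map is injective on the Specht module once it does not kill one polytabloid. The single
nonvanishing result `xiDeriv_colFermion_ne_zero` supplies this for both maps, and it also shows that
the polytabloid is nonzero, which the irreducibility statement needs. -/

theorem one_mem_colGroup {n : ℕ} {μ : YoungDiagram} (T : Tableau n μ) : 1 ∈ colGroup T :=
  fun _ => rfl

theorem mul_mem_colGroup {n : ℕ} {μ : YoungDiagram} {T : Tableau n μ} {σ τ : Perm (Fin n)}
    (hσ : σ ∈ colGroup T) (hτ : τ ∈ colGroup T) : σ * τ ∈ colGroup T :=
  fun a => (hσ (τ a)).trans (hτ a)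

theorem inv_mem_colGroup {n : ℕ} {μ : YoungDiagram} {T : Tableau n μ} {σ : Perm (Fin n)}
    (hσ : σ ∈ colGroup T) : σ⁻¹ ∈ colGroup T := fun a => by
  have := hσ (σ⁻¹ a)
  rw [← Perm.mul_apply, mul_inv_cancel] at this
  exact this.symm

open Classical in
/-- The signed sum of a representation of `𝔖_n` over the column group of `T`. -/
def colAntisym {n : ℕ} {μ : YoungDiagram} {M : Type*} [AddCommGroup M] [Module ℂ M]
    (ρ : Representation ℂ (Perm (Fin n)) M) (T : Tableau n μ) : Module.End ℂ M :=
  ∑ σ : Perm (Fin n) with σ ∈ colGroup T, ((Perm.sign σ : ℤ) : ℂ) • ρ σ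

theorem colAntisym_single_tabloid {n : ℕ} {μ : YoungDiagram} (T : Tableau n μ) :
    colAntisym (tabloidRep n) T (Finsupp.single (tabloid T) 1) = polytabloid T := by
  simp [colAntisym, polytabloid, LinearMap.sum_apply]

theorem colAntisym_apply_of_mem {n : ℕ} {μ : YoungDiagram} {M : Type*} [AddCommGroup M]
    [Module ℂ M] (ρ : Representation ℂ (Perm (Fin n)) M) (T : Tableau n μ) {τ : Perm (Fin n)}
    (hτ : τ ∈ colGroup T) (x : M) :
    colAntisym ρ T (ρ τ x) = ((Perm.sign τ : ℤ) : ℂ) • colAntisym ρ T x := by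
  classical
  simp only [colAntisym, LinearMap.sum_apply, LinearMap.smul_apply, Finset.smul_sum]
  refine Finset.sum_bij (fun σ _ => σ * τ) ?_ ?_ ?_ ?_
  · intro σ hσ
    simp only [Finset.mem_filter, Finset.mem_univ, true_and] at hσ ⊢
    exact mul_mem_colGroup hσ hτ
  · intro σ _ σ' _ h
    exact mul_right_cancel h
  · intro σ hσ
    simp only [Finset.mem_filter, Finset.mem_univ, true_and] at hσ
    refine ⟨σ * τ⁻¹, ?_, by group⟩
    simp only [Finset.mem_filter, Finset.mem_univ, true_and]
    exact mul_mem_colGroup hσ (inv_mem_colGroup hτ)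
  · intro σ _
    rw [smul_smul, map_mul ρ, Module.End.mul_apply]
    congr 1
    rw [Perm.sign_mul, mul_comm]
    norm_cast
    rw [mul_assoc, Int.units_mul_self, mul_one]

theorem colAntisym_map {n : ℕ} {μ : YoungDiagram} {M N : Type*} [AddCommGroup M]
    [Module ℂ M] [AddCommGroup N] [Module ℂ N] (ρ : Representation ℂ (Perm (Fin n)) M)
    (ρ' : Representation ℂ (Perm (Fin n)) N) (φ : M →ₗ[ℂ] N)
    (hφ : ∀ w x, φ (ρ w x) = ρ' w (φ x)) (T : Tableau n μ) (x : M) :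
    φ (colAntisym ρ T x) = colAntisym ρ' T (φ x) := by
  simp only [colAntisym, LinearMap.sum_apply, LinearMap.smul_apply, map_sum, map_smul, hφ]

theorem tabloidRep_single {n : ℕ} (w : Perm (Fin n)) (r : Fin n → ℕ) (c : ℂ) :
    tabloidRep n w (Finsupp.single r c) = Finsupp.single (r ∘ (w⁻¹ : Perm (Fin n))) c := by
  simp [tabloidRep]

theorem tabloidRep_apply {n : ℕ} (w : Perm (Fin n)) (x : (Fin n → ℕ) →₀ ℂ) (r : Fin n → ℕ) :
    tabloidRep n w x r = x (r ∘ w) := by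
  induction x using Finsupp.induction_linear with
  | zero => simp
  | add x y hx hy => simp [hx, hy]
  | single s c =>
    rw [tabloidRep_single]
    classical
    rw [Finsupp.single_apply, Finsupp.single_apply]
    congr 1
    refine propext ⟨?_, ?_⟩
    · rintro rfl; ext; simp
    · rintro rfl; ext; simp

/-- All tableaux of a given shape form one orbit, so a stable subspace that contains one polytabloid
contains them all. -/
theorem permTableau_trans_symm {n : ℕ} {μ : YoungDiagram} (T T' : Tableau n μ) :
    permTableau (T.trans T'.symm) T = T' := by
  refine Equiv.ext fun a => ?_
  simp [permTableau]

/-- If no two entries share both their row in `S` and their column in `T`, then the rows of `S` and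
the columns of `T` assemble into a tableau. -/
theorem mem_of_injective_row_col {n : ℕ} {μ : YoungDiagram} (S T : Tableau n μ)
    (h : Function.Injective fun a => ((S a).1.1, (T a).1.2)) (a : Fin n) :
    ((S a).1.1, (T a).1.2) ∈ μ := by
  classical
  let _ : Fintype {c : ℕ × ℕ // c ∈ μ} := Fintype.ofEquiv _ T
  set D : Finset (ℕ × ℕ) := Finset.univ.image fun a => ((S a).1.1, (T a).1.2) with hD
  -- This weight is negative exactly on the cells of `μ`. Its total over `D` splits into a row part,
  -- read off from `S`, and a column part, read off from `T`, so it equals the total over `μ`. A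
  -- cell of `μ` missing from `D` would make the total over `D` strictly larger.
  let wt : ℕ × ℕ → ℤ := fun c => c.1 - μ.colLen c.2
  have hcell (T : Tableau n μ) (g : ℕ × ℕ → ℤ) : ∑ a, g (T a).1 = ∑ c ∈ μ.cells, g c := by
    rw [Equiv.sum_comp T (fun c => g c.1)]
    exact (Finset.sum_subtype μ.cells (p := (· ∈ μ)) (fun c => YoungDiagram.mem_cells c) g).symm
  have hsum : ∑ c ∈ D, wt c = ∑ c ∈ μ.cells, wt c := by
    rw [hD, Finset.sum_image fun a _ b _ hab => h hab]
    simp only [wt, Finset.sum_sub_distrib]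
    rw [hcell S (fun c => c.1), hcell T (fun c => μ.colLen c.2)]
  have hneg : ∀ c ∈ μ, wt c < 0 := fun c hc => by
    have : c.1 < μ.colLen c.2 := YoungDiagram.mem_iff_lt_colLen.1 hc
    simp only [wt]; lia
  have hpos : ∀ c, c ∉ μ → 0 ≤ wt c := fun c hc => by
    have : ¬ c.1 < μ.colLen c.2 := fun h => hc (YoungDiagram.mem_iff_lt_colLen.2 h)
    simp only [wt]; omega
  have hsub : μ.cells ⊆ D := by
    rw [← Finset.sdiff_eq_empty_iff_subset]
    by_contra hne
    have h1 : ∑ c ∈ μ.cells \ D, wt c < 0 :=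
      Finset.sum_neg (fun c hc => hneg c (Finset.mem_sdiff.1 hc).1)
        (Finset.nonempty_iff_ne_empty.2 hne)
    have h2 : 0 ≤ ∑ c ∈ D \ μ.cells, wt c :=
      Finset.sum_nonneg fun c hc => hpos c (Finset.mem_sdiff.1 hc).2
    have h3 := Finset.sum_inter_add_sum_sdiff D μ.cells wt
    have h4 := Finset.sum_inter_add_sum_sdiff μ.cells D wt
    rw [Finset.inter_comm] at h4
    omega
  have hcard : D.card ≤ μ.cells.card := by
    rw [hD, Finset.card_image_of_injective _ h, Finset.card_univ, Fintype.card_congr T]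
    exact (Fintype.card_of_subtype (p := (· ∈ μ)) _ fun c => YoungDiagram.mem_cells c).le
  have := Finset.eq_of_subset_of_card_le hsub hcard
  rw [← YoungDiagram.mem_cells, this]
  exact Finset.mem_image_of_mem _ (Finset.mem_univ a)

/-- Either two entries share a row of `S` and a column of `T`, and their transposition forces the
result to vanish, or the tabloid of `S` is a column permutation of that of `T`. -/
theorem colAntisym_single_eq_smul_polytabloid {n : ℕ} {μ : YoungDiagram} (S T : Tableau n μ) :
    ∃ c : ℂ, colAntisym (tabloidRep n) T (Finsupp.single (tabloid S) 1) = c • polytabloid T := by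
  by_cases h : Function.Injective fun a => ((S a).1.1, (T a).1.2)
  · let S' : Fin n → {c : ℕ × ℕ // c ∈ μ} := fun a => ⟨_, mem_of_injective_row_col S T h a⟩
    have hS' : Function.Injective S' := fun a b hab => h (congrArg Subtype.val hab)
    let _ : Fintype {c : ℕ × ℕ // c ∈ μ} := Fintype.ofEquiv _ T
    let e : Tableau n μ := Equiv.ofBijective S' ((Fintype.bijective_iff_injective_and_card _).2
      ⟨hS', Fintype.card_congr T⟩)
    let σ : Perm (Fin n) := T.trans e.symm
    -- `e` has the rows of `S` and the columns of `T`, so passing from `T` to `e` moves entries only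
    -- within columns.
    have he (a) : e (σ a) = T a := by simp [σ]
    have hσ : σ ∈ colGroup T := fun a => by
      change (e (σ a)).1.2 = _
      rw [he]
    have hst : tabloid S = tabloid T ∘ (σ⁻¹ : Perm (Fin n)) := by
      ext a
      have := he (σ⁻¹ a)
      rw [← Perm.mul_apply, mul_inv_cancel] at this
      simp only [tabloid, Function.comp_apply, ← this]
      rfl
    refine ⟨((Perm.sign σ : ℤ) : ℂ), ?_⟩
    rw [hst, ← tabloidRep_single, colAntisym_apply_of_mem _ _ hσ, colAntisym_single_tabloid]
  · simp only [Function.Injective, not_forall] at h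
    obtain ⟨a, b, hab, hne⟩ := h
    obtain ⟨h1, h2⟩ := Prod.mk.inj hab
    refine ⟨0, ?_⟩
    have hs : swap a b ∈ colGroup T := fun c => by
      by_cases hca : c = a
      · subst hca; rw [swap_apply_left, h2]
      by_cases hcb : c = b
      · subst hcb; rw [swap_apply_right, h2]
      rw [swap_apply_of_ne_of_ne hca hcb]
    have hfix : tabloidRep n (swap a b) (Finsupp.single (tabloid S) 1) =
        Finsupp.single (tabloid S) 1 := by
      rw [tabloidRep_single]
      congr 1
      ext c
      rw [Perm.inv_def, symm_swap, Function.comp_apply]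
      by_cases hca : c = a
      · subst hca; rw [swap_apply_left]; exact h1.symm
      by_cases hcb : c = b
      · subst hcb; rw [swap_apply_right]; exact h1
      rw [swap_apply_of_ne_of_ne hca hcb]
    have := colAntisym_apply_of_mem (tabloidRep n) T hs (Finsupp.single (tabloid S) 1)
    rw [hfix, Perm.sign_swap hne] at this
    rw [zero_smul]
    simpa [self_eq_neg] using this

theorem colAntisym_eq_smul_polytabloid {n : ℕ} {μ : YoungDiagram} (T : Tableau n μ)
    {x : (Fin n → ℕ) →₀ ℂ} (hx : x ∈ (specht n μ).toSubmodule) :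
    ∃ c : ℂ, colAntisym (tabloidRep n) T x = c • polytabloid T := by
  suffices h : (specht n μ).toSubmodule ≤
      (Submodule.span ℂ {polytabloid T}).comap (colAntisym (tabloidRep n) T) by
    obtain ⟨c, hc⟩ := Submodule.mem_span_singleton.1 (h hx)
    exact ⟨c, hc.symm⟩
  refine Submodule.span_le.2 ?_
  rintro _ ⟨S, rfl⟩
  change colAntisym (tabloidRep n) T (polytabloid S) ∈ Submodule.span ℂ {polytabloid T}
  rw [polytabloid.eq_def S, map_sum]
  refine Submodule.sum_mem _ fun σ _ => ?_
  rw [map_smul, tabloidRep_single]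
  refine Submodule.smul_mem _ _ (Submodule.mem_span_singleton.2 ?_)
  obtain ⟨c, hc⟩ := colAntisym_single_eq_smul_polytabloid (permTableau σ S) T
  exact ⟨c, hc.symm⟩

/-- The antisymmetrizer is self-adjoint for the bilinear dot product, because inversion preserves
the column group and signs. The left side is the dot product of `x` with the polytabloid. -/
theorem linearCombination_polytabloid {n : ℕ} {μ : YoungDiagram} (T : Tableau n μ)
    (x : (Fin n → ℕ) →₀ ℂ) :
    Finsupp.linearCombination ℂ (x : (Fin n → ℕ) → ℂ) (polytabloid T) =
      colAntisym (tabloidRep n) T x (tabloid T) := by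
  classical
  simp only [polytabloid, colAntisym, map_sum, LinearMap.sum_apply, LinearMap.smul_apply,
    map_smul, Finsupp.finsetSum_apply, Finsupp.smul_apply, tabloidRep_single, tabloidRep_apply,
    Finsupp.linearCombination_single, one_smul]
  refine Finset.sum_nbij' (fun σ => σ⁻¹) (fun σ => σ⁻¹) ?_ ?_ ?_ ?_ ?_
  · intro σ hσ
    simp only [Finset.mem_filter, Finset.mem_univ, true_and] at hσ ⊢
    exact inv_mem_colGroup hσ
  · intro σ hσ
    simp only [Finset.mem_filter, Finset.mem_univ, true_and] at hσ ⊢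
    exact inv_mem_colGroup hσ
  · simp
  · simp
  · intro σ _
    rw [Perm.sign_inv]

/-- Polytabloids have integer coefficients and are fixed by conjugation. -/
theorem conj_mem_specht {n : ℕ} {μ : YoungDiagram} {x : (Fin n → ℕ) →₀ ℂ}
    (hx : x ∈ (specht n μ).toSubmodule) :
    Finsupp.mapRange.addMonoidHom (starRingEnd ℂ).toAddMonoidHom x ∈ (specht n μ).toSubmodule := by
  induction hx using Submodule.span_induction with
  | mem x hx =>
    obtain ⟨T, rfl⟩ := hx
    have hT : polytabloid T ∈ (specht n μ).toSubmodule := Submodule.subset_span ⟨T, rfl⟩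
    convert hT using 1
    ext r
    simp [polytabloid, tabloidRep_single, Finsupp.single_apply]
  | zero => rw [map_zero]; exact zero_mem _
  | add x y _ _ hx hy => rw [map_add]; exact add_mem hx hy
  | smul c x _ hx =>
    convert Submodule.smul_mem _ (starRingEnd ℂ c) hx using 1
    ext r
    simp

/-- Such an `x` is orthogonal to every polytabloid, hence to its own complex conjugate, which again
lies in the Specht module. So the sum of the `‖x r‖ ^ 2` is zero. -/
theorem eq_zero_of_colAntisym_eq_zero {n : ℕ} {μ : YoungDiagram} {x : (Fin n → ℕ) →₀ ℂ}
    (hx : x ∈ (specht n μ).toSubmodule)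
    (h : ∀ T : Tableau n μ, colAntisym (tabloidRep n) T x = 0) : x = 0 := by
  have hle : (specht n μ).toSubmodule ≤
      LinearMap.ker (Finsupp.linearCombination ℂ (x : (Fin n → ℕ) → ℂ)) := by
    refine Submodule.span_le.2 ?_
    rintro _ ⟨T, rfl⟩
    change Finsupp.linearCombination ℂ (x : (Fin n → ℕ) → ℂ) (polytabloid T) = 0
    rw [linearCombination_polytabloid, h T, Finsupp.zero_apply]
  have h0 := hle (conj_mem_specht hx)
  rw [LinearMap.mem_ker, Finsupp.linearCombination_apply,
    Finsupp.mapRange.addMonoidHom_apply, Finsupp.sum_mapRange_index (fun _ => by simp)] at h0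
  have h1 : ∑ r ∈ x.support, ‖x r‖ ^ 2 = 0 := by
    have : ((∑ r ∈ x.support, ‖x r‖ ^ 2 : ℝ) : ℂ) = 0 := by
      rw [← h0, Finsupp.sum]
      push_cast
      refine Finset.sum_congr rfl fun r _ => ?_
      exact (Complex.conj_mul' (x r)).symm
    exact_mod_cast this
  ext r
  by_contra hr
  have := (Finset.sum_eq_zero_iff_of_nonneg fun r _ => by positivity).1 h1 r
    (Finsupp.mem_support_iff.2 hr)
  simp_all

/-- A subspace of the Specht module that is stable under the symmetric group and nonzero is
everything. -/
theorem specht_le_of_stable {n : ℕ} {μ : YoungDiagram} (N : Submodule ℂ ((Fin n → ℕ) →₀ ℂ))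
    (hN : ∀ w, ∀ x ∈ N, tabloidRep n w x ∈ N) {x : (Fin n → ℕ) →₀ ℂ} (hxN : x ∈ N)
    (hx : x ∈ (specht n μ).toSubmodule) (hx0 : x ≠ 0) : (specht n μ).toSubmodule ≤ N := by
  classical
  have : ∃ T : Tableau n μ, colAntisym (tabloidRep n) T x ≠ 0 := by
    by_contra! h
    exact hx0 (eq_zero_of_colAntisym_eq_zero hx h)
  obtain ⟨T, hT⟩ := this
  obtain ⟨c, hc⟩ := colAntisym_eq_smul_polytabloid T hx
  have hc0 : c ≠ 0 := by rintro rfl; exact hT (by rw [hc, zero_smul])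
  have hmem : colAntisym (tabloidRep n) T x ∈ N := by
    simp only [colAntisym, LinearMap.sum_apply, LinearMap.smul_apply]
    exact Submodule.sum_mem _ fun σ _ => Submodule.smul_mem _ _ (hN σ x hxN)
  rw [hc, Submodule.smul_mem_iff _ hc0] at hmem
  refine Submodule.span_le.2 ?_
  rintro _ ⟨T', rfl⟩
  have := hN (T.trans T'.symm) _ hmem
  rwa [tabloidRep_polytabloid, permTableau_trans_symm] at this

theorem specht_isIrreducible {n : ℕ} {μ : YoungDiagram} (T : Tableau n μ)
    (hT : polytabloid T ≠ 0) :
    Representation.IsIrreducible (V := (specht n μ).toSubmodule)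
      (specht n μ).toRepresentation := by
  have hne : (⟨polytabloid T, Submodule.subset_span ⟨T, rfl⟩⟩ : (specht n μ).toSubmodule) ≠ 0 :=
    fun h => hT (congrArg Subtype.val h)
  refine { exists_pair_ne := ⟨⊥, ⊤, fun h => hne ?_⟩, eq_bot_or_eq_top := fun U => ?_ }
  · have h' := congrArg Subrepresentation.toSubmodule h
    change (⊥ : Submodule ℂ (specht n μ).toSubmodule) = ⊤ at h'
    exact (Submodule.mem_bot ℂ).1 (h' ▸ Submodule.mem_top)
  · by_cases hU : U.toSubmodule = ⊥
    · exact Or.inl (Subrepresentation.toSubmodule_injective hU)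
    · obtain ⟨x, hxU, hx0⟩ := Submodule.exists_mem_ne_zero_of_ne_bot hU
      refine Or.inr (Subrepresentation.toSubmodule_injective (eq_top_iff.2 ?_))
      have := specht_le_of_stable (μ := μ) (U.toSubmodule.map (specht n μ).toSubmodule.subtype)
        (by
          rintro w _ ⟨y, hy, rfl⟩
          exact ⟨_, U.apply_mem_toSubmodule w hy, rfl⟩) ⟨x, hxU, rfl⟩ x.2
        (fun h => hx0 (Subtype.ext h))
      intro y _
      obtain ⟨z, hz, hzy⟩ := this y.2
      rwa [← Subtype.ext hzy]

/-- An equivariant map on a Specht module that does not kill a given polytabloid maps it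
isomorphically onto the span of the images of the polytabloids. -/
theorem specht_equiv_of_map {n : ℕ} {μ : YoungDiagram} {M : Type*} [AddCommGroup M] [Module ℂ M]
    {ρ : Representation ℂ (Perm (Fin n)) M} (φ : ((Fin n → ℕ) →₀ ℂ) →ₗ[ℂ] M)
    (hφ : ∀ w x, φ (tabloidRep n w x) = ρ w (φ x)) {T : Tableau n μ} (hT : φ (polytabloid T) ≠ 0)
    (N : Subrepresentation ρ)
    (hN : N.toSubmodule = Submodule.span ℂ (Set.range fun T : Tableau n μ => φ (polytabloid T))) :
    Nonempty (N.toRepresentation.Equiv (specht n μ).toRepresentation) := by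
  have hmap : (specht n μ).toSubmodule.map φ = N.toSubmodule := by
    rw [hN, specht, Submodule.map_span, ← Set.range_comp]
    rfl
  -- The kernel of `φ` is stable. If it met the Specht module nontrivially it would contain all of
  -- it, including the polytabloid of `T`.
  have hker : ∀ x ∈ (specht n μ).toSubmodule, φ x = 0 → x = 0 := by
    intro x hx h0
    by_contra hne
    have := specht_le_of_stable (μ := μ) (LinearMap.ker φ)
      (fun w y hy => by rw [LinearMap.mem_ker] at hy ⊢; rw [hφ, hy, map_zero]) h0 hx hne
    exact hT (this (Submodule.subset_span ⟨T, rfl⟩))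
  let ψ : (specht n μ).toSubmodule →ₗ[ℂ] N.toSubmodule :=
    (φ.comp (specht n μ).toSubmodule.subtype).codRestrict N.toSubmodule
      fun x => hmap.le (Submodule.mem_map_of_mem x.2)
  have hψ : Function.Bijective ψ := by
    constructor
    · rw [injective_iff_map_eq_zero]
      intro x hx
      exact Subtype.ext (hker x x.2 (congrArg Subtype.val hx))
    · intro y
      obtain ⟨x, hx, hxy⟩ : (y : M) ∈ (specht n μ).toSubmodule.map φ := hmap.ge y.2
      exact ⟨⟨x, hx⟩, Subtype.ext hxy⟩
  refine ⟨(Representation.Equiv.mk (LinearEquiv.ofBijective ψ hψ) fun w => ?_).symm⟩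
  ext x
  exact hφ w x

/-! ### The two-block skein relation in a commutative ring -/

section Skein

variable {ι A : Type*} [DecidableEq ι] [CommRing A]

/-- The sum of `e i j` over ordered pairs of distinct elements of `B`. -/
def offDiagSum (e : ι → ι → A) (B : Finset ι) : A := ∑ p ∈ B.offDiag, e p.1 p.2

/-- `e a b * e c d`, symmetrized in each pair, restricted to pairwise distinct indices. -/
def distinctPairProd (e : ι → ι → A) (a b c d : ι) : A :=
  if a ≠ b ∧ a ≠ c ∧ a ≠ d ∧ b ≠ c ∧ b ≠ d ∧ c ≠ d then (e a b + e b a) * (e c d + e d c) else 0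

/-- The three terms run over the perfect matchings of four points. Expanded, they are twelve
products, which the exchange rule cancels in six pairs. -/
theorem distinctPairProd_add_add {e : ι → ι → A}
    (he : ∀ i j k l, e i j * e k l = -(e i l * e k j)) (a b c d : ι) :
    distinctPairProd e a b c d + distinctPairProd e a c b d + distinctPairProd e b c a d = 0 := by
  unfold distinctPairProd
  by_cases h : a ≠ b ∧ a ≠ c ∧ a ≠ d ∧ b ≠ c ∧ b ≠ d ∧ c ≠ d
  · rw [if_pos h, if_pos (by tauto), if_pos (by tauto)]
    linear_combination he a b c d + he a b d c + he b a c d + he b a d c + he a c b d + he c a d b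
  · rw [if_neg h, if_neg (by tauto), if_neg (by tauto)]
    simp

theorem two_mul_offDiagSum (e : ι → ι → A) (B : Finset ι) :
    2 * offDiagSum e B = ∑ a ∈ B, ∑ b ∈ B, if a ≠ b then e a b + e b a else 0 := by
  have h (f : ι → ι → A) : ∑ p ∈ B.offDiag, f p.1 p.2 =
      ∑ a ∈ B, ∑ b ∈ B, if a ≠ b then f a b else 0 := by
    rw [← Finset.sum_product', ← Finset.sum_filter]
    exact Finset.sum_congr (by ext; simp [and_assoc]) fun _ _ => rfl
  rw [two_mul, ← h fun a b => e a b + e b a, Finset.sum_add_distrib]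
  congr 1
  rw [offDiagSum, h e, h fun a b => e b a, Finset.sum_comm]
  simp only [ne_comm]

theorem offDiagSum_pair (e : ι → ι → A) {a b : ι} (hab : a ≠ b) :
    offDiagSum e {a, b} = e a b + e b a := by
  rw [offDiagSum, Finset.offDiag_insert (by simpa using hab)]
  simp [hab]

/-- The three-term relation is summed over `a, b ∈ X` and `c, d ∈ X ∪ Y`. The contributions with at
least three indices in `X` vanish, which leaves only `c, d ∈ Y`. -/
theorem offDiagSum_mul_offDiagSum [Algebra ℂ A] {e : ι → ι → A}
    (he : ∀ i j k l, e i j * e k l = -(e i l * e k j)) {X Y : Finset ι} (hXY : Disjoint X Y) :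
    (2 : ℂ) • (offDiagSum e X * offDiagSum e Y) =
      ∑ p ∈ X.offDiag, offDiagSum e {p.1, p.2} * offDiagSum e ((X ∪ Y) \ {p.1, p.2}) := by
  have hcancel (m : ℕ) (hm : m ≠ 0) (x : A) (hx : (m : A) * x = 0) : x = 0 := by
    have h1 : (m : ℂ) • x = 0 := by rw [Algebra.smul_def, map_natCast, hx]
    exact (smul_eq_zero.1 h1).resolve_left (Nat.cast_ne_zero.2 hm)
  set g := distinctPairProd e with hg
  -- Renaming summation variables makes the three summed terms equal, so three times the sum is
  -- zero. The same works for `hXY'`, since `a, b, c` all range over `X` there.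
  have hX : ∑ a ∈ X, ∑ b ∈ X, ∑ c ∈ X, ∑ d ∈ X, g a b c d = 0 := by
    refine hcancel 3 (by norm_num) _ ?_
    have h := Finset.sum_eq_zero fun a (_ : a ∈ X) => Finset.sum_eq_zero fun b (_ : b ∈ X) =>
      Finset.sum_eq_zero fun c (_ : c ∈ X) => Finset.sum_eq_zero fun d (_ : d ∈ X) =>
        distinctPairProd_add_add he a b c d
    simp only [Finset.sum_add_distrib] at h
    have h1 : ∑ a ∈ X, ∑ b ∈ X, ∑ c ∈ X, ∑ d ∈ X, g a c b d =
        ∑ a ∈ X, ∑ b ∈ X, ∑ c ∈ X, ∑ d ∈ X, g a b c d :=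
      Finset.sum_congr rfl fun a _ => Finset.sum_comm
    have h2 : ∑ a ∈ X, ∑ b ∈ X, ∑ c ∈ X, ∑ d ∈ X, g b c a d =
        ∑ a ∈ X, ∑ b ∈ X, ∑ c ∈ X, ∑ d ∈ X, g a b c d := by
      rw [Finset.sum_comm]
      exact Finset.sum_congr rfl fun a _ => Finset.sum_comm
    rw [← hg, h1, h2] at h
    push_cast
    linear_combination h
  have hXY' : ∑ a ∈ X, ∑ b ∈ X, ∑ c ∈ X, ∑ d ∈ Y, g a b c d = 0 := by
    refine hcancel 3 (by norm_num) _ ?_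
    have h := Finset.sum_eq_zero fun a (_ : a ∈ X) => Finset.sum_eq_zero fun b (_ : b ∈ X) =>
      Finset.sum_eq_zero fun c (_ : c ∈ X) => Finset.sum_eq_zero fun d (_ : d ∈ Y) =>
        distinctPairProd_add_add he a b c d
    simp only [Finset.sum_add_distrib] at h
    have h1 : ∑ a ∈ X, ∑ b ∈ X, ∑ c ∈ X, ∑ d ∈ Y, g a c b d =
        ∑ a ∈ X, ∑ b ∈ X, ∑ c ∈ X, ∑ d ∈ Y, g a b c d :=
      Finset.sum_congr rfl fun a _ => Finset.sum_comm
    have h2 : ∑ a ∈ X, ∑ b ∈ X, ∑ c ∈ X, ∑ d ∈ Y, g b c a d =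
        ∑ a ∈ X, ∑ b ∈ X, ∑ c ∈ X, ∑ d ∈ Y, g a b c d := by
      rw [Finset.sum_comm]
      exact Finset.sum_congr rfl fun a _ => Finset.sum_comm
    rw [← hg, h1, h2] at h
    push_cast
    linear_combination h
  have hsymm : ∀ a b c d, g a b c d = g a b d c := by
    intro a b c d
    simp only [hg, distinctPairProd]
    rw [add_comm (e d c)]
    refine if_congr ?_ rfl rfl
    tauto
  have hYX : ∑ a ∈ X, ∑ b ∈ X, ∑ c ∈ Y, ∑ d ∈ X, g a b c d = 0 := by
    rw [← hXY']
    refine Finset.sum_congr rfl fun a _ => Finset.sum_congr rfl fun b _ => ?_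
    rw [Finset.sum_comm]
    simp only [hsymm a b]
  have hYY : ∑ a ∈ X, ∑ b ∈ X, ∑ c ∈ Y, ∑ d ∈ Y, g a b c d =
      (2 * offDiagSum e X) * (2 * offDiagSum e Y) := by
    rw [two_mul_offDiagSum, two_mul_offDiagSum, Finset.sum_mul]
    refine Finset.sum_congr rfl fun a ha => ?_
    rw [Finset.sum_mul]
    refine Finset.sum_congr rfl fun b hb => ?_
    rw [Finset.mul_sum]
    refine Finset.sum_congr rfl fun c hc => ?_
    rw [Finset.mul_sum]
    refine Finset.sum_congr rfl fun d hd => ?_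
    have h1 := Finset.disjoint_iff_ne.1 hXY a ha c hc
    have h2 := Finset.disjoint_iff_ne.1 hXY a ha d hd
    have h3 := Finset.disjoint_iff_ne.1 hXY b hb c hc
    have h4 := Finset.disjoint_iff_ne.1 hXY b hb d hd
    simp only [hg, distinctPairProd]
    by_cases hab : a = b <;> by_cases hcd : c = d <;> simp [*]
  have hRHS : 2 * ∑ p ∈ X.offDiag,
        offDiagSum e {p.1, p.2} * offDiagSum e ((X ∪ Y) \ {p.1, p.2}) =
      ∑ a ∈ X, ∑ b ∈ X, ∑ c ∈ X ∪ Y, ∑ d ∈ X ∪ Y, g a b c d := by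
    rw [← Finset.sum_product', ← Finset.sum_filter_add_sum_filter_not (X ×ˢ X)
      (fun p => p.1 ≠ p.2)]
    rw [Finset.sum_eq_zero (s := Finset.filter (fun p : ι × ι => ¬ p.1 ≠ p.2) (X ×ˢ X)), add_zero,
      Finset.mul_sum]
    · refine Finset.sum_congr (by ext; simp [and_assoc]) fun p hp => ?_
      have hab := (Finset.mem_filter.1 hp).2
      obtain ⟨a, b⟩ := p
      simp only at hab ⊢
      rw [mul_left_comm, two_mul_offDiagSum, offDiagSum_pair e hab, Finset.mul_sum]
      have hout (f : ι → A) : ∑ c ∈ (X ∪ Y) \ {a, b}, f c =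
          ∑ c ∈ X ∪ Y, if a ≠ c ∧ b ≠ c then f c else 0 := by
        rw [← Finset.sum_filter]
        refine Finset.sum_congr (Finset.ext fun c => ?_) fun _ _ => rfl
        simp only [Finset.mem_sdiff, Finset.mem_filter, Finset.mem_insert, Finset.mem_singleton]
        tauto
      rw [hout]
      refine Finset.sum_congr rfl fun c _ => ?_
      rw [hout, Finset.mul_sum]
      split_ifs with hc
      · refine Finset.sum_congr rfl fun d _ => ?_
        simp only [hg, distinctPairProd]
        by_cases hd : (a ≠ d ∧ b ≠ d) ∧ c ≠ d
        · rw [if_pos hd.1, if_pos hd.2, if_pos (by tauto)]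
        · rw [if_neg (show ¬ (a ≠ b ∧ a ≠ c ∧ a ≠ d ∧ b ≠ c ∧ b ≠ d ∧ c ≠ d) by tauto)]
          split_ifs <;> first | simp | tauto
      · refine (Finset.sum_eq_zero fun d _ => ?_).symm
        simp only [hg, distinctPairProd]
        rw [if_neg (by tauto)]
    · intro p hp
      have hp' := (Finset.mem_filter.1 hp).2
      refine Finset.sum_eq_zero fun c _ => Finset.sum_eq_zero fun d _ => ?_
      simp only [hg, distinctPairProd]
      rw [if_neg (by tauto)]
  simp only [Finset.sum_union hXY, Finset.sum_add_distrib] at hRHS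
  rw [hX, hXY', hYX, hYY] at hRHS
  rw [← sub_eq_zero]
  refine hcancel 2 (by norm_num) _ ?_
  rw [Algebra.smul_def, map_ofNat]
  push_cast
  linear_combination -hRHS

/-- Products over a family of disjoint blocks with union `U`, all of which are pairs except that
one of them, in addition to `m` pairs, may be larger. -/
def flagProducts (e : ι → ι → A) (U : Finset ι) (m : ℕ) : Set A :=
  {x | ∃ (P : Finset (Finset ι)) (C : Finset ι), 2 ≤ C.card ∧ (∀ p ∈ P, p.card = 2) ∧
    (P : Set (Finset ι)).PairwiseDisjoint id ∧ (∀ p ∈ P, Disjoint p C) ∧ C ∪ P.sup id = U ∧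
    P.card = m ∧ x = offDiagSum e C * ∏ p ∈ P, offDiagSum e p}

/-- The skein relation for `C` and `Y` splits a pair off `C` and merges the rest of `C` with `Y`.
Each term has one more pair and again a single block of unrestricted size. -/
theorem offDiagSum_mul_mem_span_flagProducts [Algebra ℂ A] {e : ι → ι → A}
    (he : ∀ i j k l, e i j * e k l = -(e i l * e k j)) {U Y : Finset ι} {m : ℕ}
    (hY : 2 ≤ Y.card) (hYU : Disjoint Y U) {x : A} (hx : x ∈ flagProducts e U m) :
    offDiagSum e Y * x ∈ Submodule.span ℂ (flagProducts e (Y ∪ U) (m + 1)) := by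
  obtain ⟨P, C, hC, hP, hPd, hPC, hU, hm, rfl⟩ := hx
  have hCU : C ⊆ U := hU ▸ Finset.subset_union_left
  have hPU : ∀ p ∈ P, p ⊆ U := fun p hp =>
    (Finset.le_sup (f := id) hp).trans (hU ▸ Finset.subset_union_right)
  have hCY : Disjoint C Y := (hYU.mono_right hCU).symm
  have hskein := offDiagSum_mul_offDiagSum he hCY
  have : offDiagSum e Y * (offDiagSum e C * ∏ p ∈ P, offDiagSum e p) =
      (2⁻¹ : ℂ) • ∑ p ∈ C.offDiag, offDiagSum e ((C ∪ Y) \ {p.1, p.2}) *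
        (offDiagSum e {p.1, p.2} * ∏ p ∈ P, offDiagSum e p) := by
    rw [eq_inv_smul_iff₀ (two_ne_zero), ← mul_assoc, mul_comm (offDiagSum e Y), ← smul_mul_assoc,
      hskein, Finset.sum_mul]
    exact Finset.sum_congr rfl fun p _ => by ring
  rw [this]
  refine Submodule.smul_mem _ _ (Submodule.sum_mem _ fun p hp => Submodule.subset_span ?_)
  obtain ⟨h1, h2, hne⟩ := Finset.mem_offDiag.1 hp
  set r : Finset ι := {p.1, p.2} with hr
  have hrC : r ⊆ C := by
    intro x hx
    rcases Finset.mem_insert.1 hx with rfl | hx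
    · exact h1
    · rwa [Finset.mem_singleton.1 hx]
  have hrcard : r.card = 2 := Finset.card_pair hne
  have hrP : ∀ p ∈ P, Disjoint p r := fun p hp => (hPC p hp).mono_right hrC
  have hrnot : r ∉ P := fun h => by
    have := hrP r h
    rw [disjoint_self, Finset.bot_eq_empty] at this
    rw [this] at hrcard
    simp at hrcard
  -- The new large block contains `Y`, so it still has at least two elements.
  have hYr : Y ⊆ (C ∪ Y) \ r := fun y hy => Finset.mem_sdiff.2
    ⟨Finset.mem_union_right _ hy, fun h => Finset.disjoint_left.1 hCY (hrC h) hy⟩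
  refine ⟨insert r P, (C ∪ Y) \ r, hY.trans (Finset.card_le_card hYr), ?_, ?_, ?_, ?_, ?_, ?_⟩
  · simpa [hrcard] using hP
  · rw [Finset.coe_insert]
    exact hPd.insert fun p hp _ => (hrP p hp).symm
  · intro p hp
    rcases Finset.mem_insert.1 hp with rfl | hp
    · exact Finset.disjoint_sdiff
    · refine Disjoint.mono_right Finset.sdiff_subset (Finset.disjoint_union_right.2 ⟨hPC p hp, ?_⟩)
      exact (hYU.mono_right (hPU p hp)).symm
  · rw [Finset.sup_insert, ← hU, id, Finset.sup_eq_union, ← Finset.union_assoc,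
      Finset.sdiff_union_of_subset (hrC.trans Finset.subset_union_left), Finset.union_comm C Y,
      Finset.union_assoc]
  · rw [Finset.card_insert_of_notMem hrnot, hm]
  · rw [Finset.prod_insert hrnot]

theorem prod_offDiagSum_mem_span_flagProducts [Algebra ℂ A] {e : ι → ι → A}
    (he : ∀ i j k l, e i j * e k l = -(e i l * e k j)) {s : Finset (Finset ι)} (hs : s.Nonempty)
    (hcard : ∀ B ∈ s, 2 ≤ B.card) (hd : (s : Set (Finset ι)).PairwiseDisjoint id) :
    ∏ B ∈ s, offDiagSum e B ∈ Submodule.span ℂ (flagProducts e (s.sup id) (s.card - 1)) := by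
  induction hs using Finset.Nonempty.cons_induction with
  | singleton B =>
    refine Submodule.subset_span ⟨∅, B, hcard B (by simp), ?_⟩
    simp
  | cons B s hB hs ih =>
    have hs' := ih (fun C hC => hcard C (Finset.mem_cons_of_mem hC))
      (hd.subset fun C hC => Finset.mem_cons_of_mem hC)
    rw [Finset.prod_cons, Finset.sup_cons, Finset.card_cons, Nat.add_sub_cancel]
    have hdisj : Disjoint B (s.sup id) := by
      rw [Finset.disjoint_sup_right]
      exact fun C hC => hd (Finset.mem_cons_self B s) (Finset.mem_cons_of_mem hC)
        (fun h => hB (h ▸ hC))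
    have hpos := hs.card_pos
    refine Submodule.span_induction (p := fun x _ => offDiagSum e B * x ∈
      Submodule.span ℂ (flagProducts e (B ∪ s.sup id) s.card)) ?_ ?_ ?_ ?_ hs'
    · intro x hx
      have := offDiagSum_mul_mem_span_flagProducts he (hcard B (Finset.mem_cons_self B s)) hdisj hx
      rwa [Nat.sub_add_cancel hpos] at this
    · rw [mul_zero]; exact zero_mem _
    · intro x y _ _ hx hy
      rw [mul_add]; exact add_mem hx hy
    · intro c x _ hx
      rw [mul_smul_comm]; exact Submodule.smul_mem _ _ hx

end Skein

/-! ### The commutative algebra generated by the operators `ξ_i · (θ_j ⊙ -)` -/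

/-- The algebra of operators generated by the `elemOp i j`. -/
def opAlg (n : ℕ) : Subalgebra ℂ (Module.End ℂ (Ext n)) :=
  Algebra.adjoin ℂ (Set.range fun p : Fin n × Fin n => elemOp p.1 p.2)

/-- Commutativity allows ordinary finite products and the skein relation, which is proved for
commutative rings. -/
instance opAlgCommRing (n : ℕ) : CommRing (opAlg n) :=
  { (opAlg n).toRing with
    mul_comm := (Algebra.isMulCommutative_adjoin ℂ (by
      rintro _ ⟨p, rfl⟩ _ ⟨q, rfl⟩
      exact elemOp_commute _ _ _ _)).is_comm.comm }

/-- `elemOp i j` as an element of `opAlg n`. -/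
def opE {n : ℕ} (i j : Fin n) : opAlg n :=
  ⟨elemOp i j, Algebra.subset_adjoin ⟨(i, j), rfl⟩⟩

/-- Exchanging the two `θ`-contractions costs one sign, while the `ξ`'s stay in place. -/
theorem opE_mul_opE {n : ℕ} (i j k l : Fin n) : opE i j * opE k l = -(opE i l * opE k j) := by
  refine Subtype.ext (LinearMap.ext fun f => ?_)
  change elemOp i j (elemOp k l f) = -elemOp i l (elemOp k j f)
  simp only [elemOp_apply, contract_gen_mul, reduceCtorEq, if_false, zero_sub, mul_neg]
  rw [contract_comm (Sum.inl j), mul_neg, mul_neg]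

theorem coe_offDiagSum_opE {n : ℕ} {B : Finset (Fin n)} (hB : B.card ≠ 1) :
    (offDiagSum opE B).1 = blockOp B := by
  rw [blockOp, if_neg hB, offDiagSum]
  exact map_sum (opAlg n).val _ _

theorem noncommProd_blockOp {n : ℕ} (s : Finset (Finset (Fin n))) (hs : ∀ B ∈ s, B.card ≠ 1) :
    s.noncommProd blockOp (blockOp_pairwise _) = (∏ B ∈ s, offDiagSum opE B : opAlg n).1 := by
  induction s using Finset.cons_induction with
  | empty => rfl
  | cons B s hB ih =>
    rw [noncommProd_blockOp_cons, Finset.prod_cons, ih fun C hC => hs C (Finset.mem_cons_of_mem hC),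
      ← coe_offDiagSum_opE (hs B (Finset.mem_cons_self B s))]
    rfl

/-- Evaluation of the operators of `opAlg n` at `θ_1 ⋯ θ_n`. -/
def evalThetaTop (n : ℕ) : opAlg n →ₗ[ℂ] Ext n :=
  (LinearMap.applyₗ (thetaTop n)).comp (opAlg n).val.toLinearMap

theorem evalThetaTop_apply {n : ℕ} (x : opAlg n) : evalThetaTop n x = x.1 (thetaTop n) := rfl

theorem card_ne_one_of_numSingletons {n : ℕ} {π : SetPart n} (hπ : numSingletons π = 0)
    {B : Finset (Fin n)} (hB : B ∈ π.parts) : B.card ≠ 1 := fun h => by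
  rw [numSingletons, Finset.card_eq_zero, Finset.filter_eq_empty_iff] at hπ
  exact hπ hB h

theorem fermionF_eq_evalThetaTop {n : ℕ} {π : SetPart n} (hπ : numSingletons π = 0) :
    fermionF π = evalThetaTop n (∏ B ∈ π.parts, offDiagSum opE B) := by
  rw [fermionF, rho, noncommProd_blockOp _ fun B hB => card_ne_one_of_numSingletons hπ hB]
  rfl

theorem extRep_prod_apply {n : ℕ} {κ : Type*} (w : Perm (Fin n)) (s : Finset κ)
    (x y : κ → opAlg n) (h : ∀ j ∈ s, ∀ f, extRep n w ((x j).1 f) = (y j).1 (extRep n w f))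
    (f : Ext n) :
    extRep n w ((∏ j ∈ s, x j : opAlg n).1 f) = (∏ j ∈ s, y j : opAlg n).1 (extRep n w f) := by
  induction s using Finset.cons_induction with
  | empty => rfl
  | cons j s hj ih =>
    rw [Finset.prod_cons, Finset.prod_cons]
    refine (h j (Finset.mem_cons_self j s) _).trans ?_
    rw [ih fun i hi => h i (Finset.mem_cons_of_mem hi)]
    rfl

/-! ### Columns of tableaux -/

/-- The set of entries in column `j` of a tableau. -/
def colBlock {n : ℕ} {μ : YoungDiagram} (T : Tableau n μ) (j : ℕ) : Finset (Fin n) :=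
  Finset.univ.filter fun a => (T a).1.2 = j

theorem mem_colBlock {n : ℕ} {μ : YoungDiagram} {T : Tableau n μ} {j : ℕ} {a : Fin n} :
    a ∈ colBlock T j ↔ (T a).1.2 = j := by
  simp [colBlock]

theorem card_colBlock {n : ℕ} {μ : YoungDiagram} (T : Tableau n μ) (j : ℕ) :
    (colBlock T j).card = μ.colLen j := by
  rw [YoungDiagram.colLen_eq_card]
  refine Finset.card_bij (fun a _ => (T a).1) ?_ ?_ ?_
  · intro a ha
    exact YoungDiagram.mem_col_iff.2 ⟨(T a).2, mem_colBlock.1 ha⟩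
  · intro a _ b _ h
    exact T.injective (Subtype.ext h)
  · intro c hc
    obtain ⟨h1, h2⟩ := YoungDiagram.mem_col_iff.1 hc
    exact ⟨T.symm ⟨c, h1⟩, mem_colBlock.2 (by simpa using h2), by simp⟩

theorem disjoint_colBlock {n : ℕ} {μ : YoungDiagram} (T : Tableau n μ) {i j : ℕ} (hij : i ≠ j) :
    Disjoint (colBlock T i) (colBlock T j) :=
  Finset.disjoint_left.2 fun _ hi hj => hij ((mem_colBlock.1 hi).symm.trans (mem_colBlock.1 hj))

/-- A disjoint family of sets of the sizes of the columns of `μ` is the family of columns of a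
tableau. -/
theorem exists_tableau_colBlock {n : ℕ} {μ : YoungDiagram} (D : ℕ → Finset (Fin n))
    (hd : ∀ i j, i ≠ j → Disjoint (D i) (D j)) (hcov : ∀ a, ∃ j, a ∈ D j)
    (hcard : ∀ j, (D j).card = μ.colLen j) : ∃ T : Tableau n μ, ∀ j, colBlock T j = D j := by
  classical
  choose c hc using hcov
  have hmem (a j) : a ∈ D j ↔ c a = j := by
    constructor
    · intro h
      by_contra hne
      exact Finset.disjoint_left.1 (hd _ _ hne) (hc a) h
    · rintro rfl; exact hc a
  have hfib (j : ℕ) : Nonempty ({a // c a = j} ≃ {x : {x : ℕ × ℕ // x ∈ μ} // x.1.2 = j}) := by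
    have e1 : {a // c a = j} ≃ {a // a ∈ D j} :=
      Equiv.subtypeEquivRight fun a => (hmem a j).symm
    have e2 : {x : {x : ℕ × ℕ // x ∈ μ} // x.1.2 = j} ≃ {x // x ∈ μ.col j} :=
      (Equiv.subtypeSubtypeEquivSubtypeInter (· ∈ μ) fun x => x.2 = j).trans
        (Equiv.subtypeEquivRight fun x => YoungDiagram.mem_col_iff.symm)
    refine ⟨e1.trans ((Finset.equivOfCardEq ?_).trans e2.symm)⟩
    rw [hcard, YoungDiagram.colLen_eq_card]
  have e := fun j => (hfib j).some
  refine ⟨Equiv.ofFiberEquiv (f := c) (g := fun x : {x : ℕ × ℕ // x ∈ μ} => x.1.2) e, fun j => ?_⟩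
  ext a
  rw [mem_colBlock, hmem]
  exact Eq.congr_left (Equiv.ofFiberEquiv_map (g := fun x : {x : ℕ × ℕ // x ∈ μ} => x.1.2) e a)

theorem map_colBlock_of_mem {n : ℕ} {μ : YoungDiagram} {T : Tableau n μ} {σ : Perm (Fin n)}
    (hσ : σ ∈ colGroup T) (j : ℕ) : (colBlock T j).map σ.toEmbedding = colBlock T j := by
  ext a
  rw [Finset.mem_map_equiv, mem_colBlock, mem_colBlock]
  have := inv_mem_colGroup hσ a
  rw [Perm.inv_def] at this
  rw [this]

/-! ### Flag-shaped tableaux -/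

theorem mem_flagShape {n k : ℕ} {hk : 1 ≤ k} {i j : ℕ} :
    (i, j) ∈ flagShape n k hk ↔ (i < 2 ∧ j < k) ∨ (2 ≤ i ∧ i < n - 2 * k + 2 ∧ j = 0) := by
  rw [flagShape, YoungDiagram.mem_ofRowLens]
  rcases i with _ | _ | i
  · simp
  · simp
  · simp

theorem colLen_flagShape_zero {n k : ℕ} (hk : 1 ≤ k) :
    (flagShape n k hk).colLen 0 = n - 2 * k + 2 := by
  have h (i : ℕ) : i < (flagShape n k hk).colLen 0 ↔ i < n - 2 * k + 2 := by
    rw [← YoungDiagram.mem_iff_lt_colLen, mem_flagShape]; omega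
  exact le_antisymm (not_lt.1 fun h' => lt_irrefl _ ((h _).1 h'))
    (not_lt.1 fun h' => lt_irrefl _ ((h _).2 h'))

theorem colLen_flagShape_of_ne_zero {n k : ℕ} (hk : 1 ≤ k) {j : ℕ} (hj : j ≠ 0) (hjk : j < k) :
    (flagShape n k hk).colLen j = 2 := by
  have h (i : ℕ) : i < (flagShape n k hk).colLen j ↔ i < 2 := by
    rw [← YoungDiagram.mem_iff_lt_colLen, mem_flagShape]; omega
  exact le_antisymm (not_lt.1 fun h' => lt_irrefl _ ((h _).1 h'))
    (not_lt.1 fun h' => lt_irrefl _ ((h _).2 h'))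

theorem colLen_flagShape_of_le {n k : ℕ} (hk : 1 ≤ k) {j : ℕ} (hjk : k ≤ j) :
    (flagShape n k hk).colLen j = 0 := by
  have h (i : ℕ) : ¬ i < (flagShape n k hk).colLen j := by
    rw [← YoungDiagram.mem_iff_lt_colLen, mem_flagShape]; omega
  simpa using h 0

theorem two_le_colLen_flagShape {n k : ℕ} (hk : 1 ≤ k) {j : ℕ} (hjk : j < k) :
    2 ≤ (flagShape n k hk).colLen j := by
  rcases eq_or_ne j 0 with rfl | hj
  · rw [colLen_flagShape_zero]; omega
  · rw [colLen_flagShape_of_ne_zero hk hj hjk]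

theorem col_lt {n k : ℕ} {hk : 1 ≤ k} (T : Tableau n (flagShape n k hk)) (a : Fin n) :
    (T a).1.2 < k := by
  have : ((T a).1.1, (T a).1.2) ∈ flagShape n k hk := (T a).2
  rw [mem_flagShape] at this
  omega

/-- The product of the block operators of the columns of a flag-shaped tableau. -/
def colOp {n k : ℕ} {hk : 1 ≤ k} (T : Tableau n (flagShape n k hk)) : opAlg n :=
  ∏ j : Fin k, offDiagSum opE (colBlock T j)

/-- The fermion of the partition into the columns of a flag-shaped tableau. -/
def colFermion {n k : ℕ} {hk : 1 ≤ k} (T : Tableau n (flagShape n k hk)) : Ext n :=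
  evalThetaTop n (colOp T)

/-- Each of the `k` columns has at least two cells, so the columns are distinct, nonempty and not
singletons. -/
theorem exists_partSet_fermionF {n k : ℕ} {hk : 1 ≤ k} (T : Tableau n (flagShape n k hk)) :
    ∃ π ∈ partSet n k 0, fermionF π = colFermion T := by
  classical
  have hcard (j : Fin k) : 2 ≤ (colBlock T j).card := by
    rw [card_colBlock]; exact two_le_colLen_flagShape hk j.2
  have hinj : Function.Injective fun j : Fin k => colBlock T j := by
    intro i j hij
    by_contra hne
    have := disjoint_colBlock T (fun h => hne (Fin.ext h))
    simp only at hij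
    rw [hij, disjoint_self, Finset.bot_eq_empty] at this
    have := hcard j
    simp_all
  let π : SetPart n :=
    { parts := Finset.univ.image fun j : Fin k => colBlock T j
      supIndep := by
        rw [Finset.supIndep_iff_pairwiseDisjoint]
        intro A hA B hB hAB
        simp only [Finset.coe_image, Finset.coe_univ, Set.image_univ, Set.mem_range] at hA hB
        obtain ⟨i, rfl⟩ := hA
        obtain ⟨j, rfl⟩ := hB
        exact disjoint_colBlock T fun h => hAB (by rw [h])
      sup_parts := by
        ext a
        simp only [Finset.mem_sup, Finset.mem_univ, iff_true]
        exact ⟨colBlock T (T a).1.2, Finset.mem_image.2 ⟨⟨_, col_lt T a⟩, Finset.mem_univ _, rfl⟩,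
          mem_colBlock.2 rfl⟩
      bot_notMem := by
        intro h
        obtain ⟨j, -, hj⟩ := Finset.mem_image.1 h
        have := hcard j
        rw [hj] at this
        simp at this }
  have hsing : numSingletons π = 0 := by
    rw [numSingletons, Finset.card_eq_zero, Finset.filter_eq_empty_iff]
    intro B hB h1
    obtain ⟨j, -, rfl⟩ := Finset.mem_image.1 hB
    have := hcard j
    omega
  refine ⟨π, ⟨?_, hsing⟩, ?_⟩
  · change (Finset.univ.image fun j : Fin k => colBlock T j).card = k
    rw [Finset.card_image_of_injective _ hinj, Finset.card_univ, Fintype.card_fin]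
  · rw [fermionF_eq_evalThetaTop hsing, colFermion, colOp]
    congr 1
    exact Finset.prod_image fun i _ j _ h => hinj h

theorem flagProducts_subset_range_colOp {n k : ℕ} (hk : 1 ≤ k) (hkn : 2 * k ≤ n) :
    flagProducts opE (Finset.univ : Finset (Fin n)) (k - 1) ⊆
      Set.range fun T : Tableau n (flagShape n k hk) => colOp T := by
  classical
  rintro _ ⟨P, C, -, hP, hPd, hPC, hU, hm, rfl⟩
  obtain ⟨k, rfl⟩ : ∃ l, k = l + 1 := ⟨k - 1, by omega⟩
  rw [Nat.add_sub_cancel] at hm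
  let e : P ≃ Fin k := P.equivFinOfCardEq hm
  -- The large block becomes column `0` and the pairs become the remaining columns. Beyond the last
  -- column the value is `∅`, in agreement with column length `0`.
  let D : ℕ → Finset (Fin n) := fun j => match j with
    | 0 => C
    | j + 1 => if h : j < k then (e.symm ⟨j, h⟩).1 else ∅
  have hDs (j : Fin k) : D (j + 1) = (e.symm j).1 := dif_pos j.2
  have hDo (j : ℕ) (h : ¬ j < k) : D (j + 1) = ∅ := dif_neg h
  -- The size of the large block is forced: the pairs use up `2k` of the `n` elements (here `k` is
  -- one less than the number of blocks).
  have hC : C.card = n - 2 * (k + 1) + 2 := by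
    have hdis : Disjoint C (P.sup id) := Finset.disjoint_sup_right.2 fun p hp => (hPC p hp).symm
    have h1 := congrArg Finset.card hU
    rw [Finset.card_union_of_disjoint hdis, Finset.sup_eq_biUnion, Finset.card_biUnion hPd,
      Finset.sum_congr (s₁ := P) (f := fun u => (id u).card) (g := fun _ => 2) rfl hP, Finset.sum_const, hm, Finset.card_univ, Fintype.card_fin] at h1
    simp only [smul_eq_mul] at h1
    omega
  have hdsucc (i j : ℕ) (hij : i ≠ j) : Disjoint (D (i + 1)) (D (j + 1)) := by
    by_cases hi : i < k
    · by_cases hj : j < k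
      · rw [hDs ⟨i, hi⟩, hDs ⟨j, hj⟩]
        refine hPd (e.symm _).2 (e.symm _).2 fun h => hij ?_
        simpa using e.symm.injective (Subtype.ext h)
      · rw [hDo j hj]; exact Finset.disjoint_empty_right _
    · rw [hDo i hi]; exact Finset.disjoint_empty_left _
  have hdzero (j : ℕ) : Disjoint (D (j + 1)) C := by
    by_cases hj : j < k
    · rw [hDs ⟨j, hj⟩]; exact hPC _ (e.symm _).2
    · rw [hDo j hj]; exact Finset.disjoint_empty_left _
  obtain ⟨T, hT⟩ := exists_tableau_colBlock (μ := flagShape n (k + 1) hk) D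
    (by
      rintro (_ | i) (_ | j) hij
      · exact absurd rfl hij
      · exact (hdzero j).symm
      · exact hdzero i
      · exact hdsucc i j (by omega))
    (by
      intro a
      have ha : a ∈ C ∪ P.sup id := hU ▸ Finset.mem_univ a
      rcases Finset.mem_union.1 ha with ha | ha
      · exact ⟨0, ha⟩
      · obtain ⟨p, hp, hap⟩ := Finset.mem_sup.1 ha
        refine ⟨e ⟨p, hp⟩ + 1, ?_⟩
        rw [hDs, Equiv.symm_apply_apply]
        exact hap)
    (by
      rintro (_ | j)
      · rw [colLen_flagShape_zero]; exact hC
      · by_cases hj : j < k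
        · rw [hDs ⟨j, hj⟩, colLen_flagShape_of_ne_zero hk (by omega) (by omega)]
          exact hP _ (e.symm _).2
        · rw [hDo j hj, colLen_flagShape_of_le hk (by omega), Finset.card_empty])
  refine ⟨T, ?_⟩
  simp only [colOp, hT]
  rw [Fin.prod_univ_succ]
  congr 1
  rw [← Finset.prod_coe_sort P, ← e.symm.prod_comp]
  refine Finset.prod_congr rfl fun j _ => ?_
  rw [← hDs j]
  rfl

theorem span_fermionF_partSet {n k : ℕ} (hk : 1 ≤ k) (hkn : 2 * k ≤ n) :
    Submodule.span ℂ (fermionF '' partSet n k 0) =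
      Submodule.span ℂ (Set.range fun T : Tableau n (flagShape n k hk) => colFermion T) := by
  refine le_antisymm (Submodule.span_le.2 ?_) (Submodule.span_mono ?_)
  · rintro _ ⟨π, ⟨hcard, hsing⟩, rfl⟩
    have hne : π.parts.Nonempty := Finset.card_pos.1 (by omega)
    have h := prod_offDiagSum_mem_span_flagProducts opE_mul_opE hne
      (fun B hB => by
        have h1 := card_ne_one_of_numSingletons hsing hB
        have h2 := (π.nonempty_of_mem_parts hB).card_pos
        omega) (Finset.supIndep_iff_pairwiseDisjoint.1 π.supIndep)
    rw [π.sup_parts, hcard] at h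
    have h' := Submodule.mem_map_of_mem (f := evalThetaTop n)
      (Submodule.span_mono (flagProducts_subset_range_colOp hk hkn) h)
    rw [Submodule.map_span, ← Set.range_comp, ← fermionF_eq_evalThetaTop hsing] at h'
    exact h'
  · rintro _ ⟨T, rfl⟩
    obtain ⟨π, hπ, h⟩ := exists_partSet_fermionF T
    exact ⟨π, hπ, h⟩

theorem exists_tableau_flagShape {n k : ℕ} (hk : 1 ≤ k) (hkn : 2 * k ≤ n) :
    Nonempty (Tableau n (flagShape n k hk)) := by
  have hmem (x : ℕ × ℕ) : x ∈ (flagShape n k hk).cells ↔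
      x ∈ Finset.range 2 ×ˢ Finset.range k ∪ Finset.Ico 2 (n - 2 * k + 2) ×ˢ {0} := by
    obtain ⟨i, j⟩ := x
    rw [YoungDiagram.mem_cells, mem_flagShape]
    simp [and_assoc, eq_comm]
  have hcard : (flagShape n k hk).cells.card = n := by
    rw [Finset.ext hmem, Finset.card_union_of_disjoint]
    · simp
      omega
    · rw [Finset.disjoint_left]
      rintro ⟨i, j⟩ h1 h2
      simp at h1 h2
      omega
  let e : Fin n ≃ (flagShape n k hk).cells := (Finset.equivFinOfCardEq hcard).symm
  exact ⟨e.trans (Equiv.subtypeEquivRight fun x => YoungDiagram.mem_cells x)⟩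

/-! ### Antisymmetrizing a product of `elemOp`s over the columns of a tableau -/

theorem exists_perm_apply_pair {α : Type*} [DecidableEq α] {x y x' y' : α} (hxy : x ≠ y)
    (hxy' : x' ≠ y') : ∃ σ : Perm α, σ x = x' ∧ σ y = y' := by
  refine ⟨swap (swap x x' y) y' * swap x x', ?_, ?_⟩
  · rw [Perm.mul_apply, swap_apply_left, swap_apply_of_ne_of_ne _ hxy']
    intro h
    have h1 : swap x x' x = swap x x' y := (swap_apply_left x x').trans h
    exact hxy ((swap x x').injective h1)
  · rw [Perm.mul_apply, swap_apply_left]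

/-- The entry of a flag-shaped tableau in row `0` and column `j`. -/
def topEntry {n k : ℕ} {hk : 1 ≤ k} (T : Tableau n (flagShape n k hk)) (j : Fin k) : Fin n :=
  T.symm ⟨(0, j), mem_flagShape.2 (Or.inl ⟨by norm_num, j.2⟩)⟩

/-- The entry of a flag-shaped tableau in row `1` and column `j`. -/
def secondEntry {n k : ℕ} {hk : 1 ≤ k} (T : Tableau n (flagShape n k hk)) (j : Fin k) : Fin n :=
  T.symm ⟨(1, j), mem_flagShape.2 (Or.inl ⟨by norm_num, j.2⟩)⟩

theorem apply_topEntry {n k : ℕ} {hk : 1 ≤ k} (T : Tableau n (flagShape n k hk)) (j : Fin k) :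
    (T (topEntry T j)).1 = (0, (j : ℕ)) := by
  simp [topEntry]

theorem apply_secondEntry {n k : ℕ} {hk : 1 ≤ k} (T : Tableau n (flagShape n k hk)) (j : Fin k) :
    (T (secondEntry T j)).1 = (1, (j : ℕ)) := by
  simp [secondEntry]

theorem topEntry_ne_secondEntry {n k : ℕ} {hk : 1 ≤ k} (T : Tableau n (flagShape n k hk))
    (i j : Fin k) : topEntry T i ≠ secondEntry T j := fun h => by
  have h1 := apply_topEntry T i
  rw [h, apply_secondEntry] at h1
  simp at h1

theorem topEntry_injective {n k : ℕ} {hk : 1 ≤ k} (T : Tableau n (flagShape n k hk)) :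
    Function.Injective (topEntry T) := fun i j h => by
  have h1 := apply_topEntry T i
  rw [h, apply_topEntry] at h1
  exact (Fin.ext (Prod.mk.inj h1).2).symm

theorem secondEntry_injective {n k : ℕ} {hk : 1 ≤ k} (T : Tableau n (flagShape n k hk)) :
    Function.Injective (secondEntry T) := fun i j h => by
  have h1 := apply_secondEntry T i
  rw [h, apply_secondEntry] at h1
  exact (Fin.ext (Prod.mk.inj h1).2).symm

/-- The column group permutes the columns' entries independently, and within one column it is
transitive on ordered pairs of distinct entries. So it carries the two upper entries to any
prescribed choice. -/
theorem exists_mem_colGroup {n k : ℕ} {hk : 1 ≤ k} (T : Tableau n (flagShape n k hk))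
    (f : Fin k → Fin n × Fin n) (hf : ∀ j : Fin k, f j ∈ (colBlock T j).offDiag) :
    ∃ τ ∈ colGroup T, ∀ j, τ (topEntry T j) = (f j).1 ∧ τ (secondEntry T j) = (f j).2 := by
  classical
  have h (j : ℕ) : ∃ e : Perm {a // (T a).1.2 = j}, ∀ hj : j < k,
      e ⟨topEntry T ⟨j, hj⟩, by rw [apply_topEntry]⟩ =
        ⟨(f ⟨j, hj⟩).1, mem_colBlock.1 (Finset.mem_offDiag.1 (hf ⟨j, hj⟩)).1⟩ ∧
      e ⟨secondEntry T ⟨j, hj⟩, by rw [apply_secondEntry]⟩ =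
        ⟨(f ⟨j, hj⟩).2, mem_colBlock.1 (Finset.mem_offDiag.1 (hf ⟨j, hj⟩)).2.1⟩ := by
    by_cases hj : j < k
    · obtain ⟨σ, h1, h2⟩ := exists_perm_apply_pair
        (x := (⟨topEntry T ⟨j, hj⟩, by rw [apply_topEntry]⟩ : {a // (T a).1.2 = j}))
        (y := ⟨secondEntry T ⟨j, hj⟩, by rw [apply_secondEntry]⟩)
        (x' := ⟨(f ⟨j, hj⟩).1, mem_colBlock.1 (Finset.mem_offDiag.1 (hf ⟨j, hj⟩)).1⟩)
        (y' := ⟨(f ⟨j, hj⟩).2, mem_colBlock.1 (Finset.mem_offDiag.1 (hf ⟨j, hj⟩)).2.1⟩)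
        (fun h => topEntry_ne_secondEntry T _ _ (congrArg Subtype.val h))
        (fun h => (Finset.mem_offDiag.1 (hf ⟨j, hj⟩)).2.2 (congrArg Subtype.val h))
      exact ⟨σ, fun _ => ⟨h1, h2⟩⟩
    · exact ⟨1, fun h => absurd h hj⟩
  choose e he using h
  let τ : Perm (Fin n) :=
    Equiv.ofFiberEquiv (f := fun a => (T a).1.2) (g := fun a => (T a).1.2) e
  have hτ (a : Fin n) (j : ℕ) (h : (T a).1.2 = j) : τ a = (e j ⟨a, h⟩).1 := by
    subst h; rfl
  refine ⟨τ, fun a => Equiv.ofFiberEquiv_map (g := fun a => (T a).1.2) e a, fun j => ⟨?_, ?_⟩⟩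
  · rw [hτ _ j (by rw [apply_topEntry]), (he j j.2).1]
  · rw [hτ _ j (by rw [apply_secondEntry]), (he j j.2).2]

theorem extRep_evalThetaTop_prod_opE {n k : ℕ} (w : Perm (Fin n)) (f g : Fin k → Fin n) :
    extRep n w (evalThetaTop n (∏ j, opE (f j) (g j))) =
      ((Perm.sign w : ℤ) : ℂ) • evalThetaTop n (∏ j, opE (w (f j)) (w (g j))) := by
  rw [evalThetaTop_apply, extRep_prod_apply w _ _ (fun j => opE (w (f j)) (w (g j)))
    (fun j _ x => extRep_elemOp w _ _ x), extRep_thetaTop, map_zsmul, Int.cast_smul_eq_zsmul]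
  rfl

/-- A column permutation fixes each column as a set, hence fixes the operator; only the sign from
`θ_1 ⋯ θ_n` remains. -/
theorem extRep_colFermion_of_mem {n k : ℕ} {hk : 1 ≤ k} (T : Tableau n (flagShape n k hk))
    {σ : Perm (Fin n)} (hσ : σ ∈ colGroup T) :
    extRep n σ (colFermion T) = ((Perm.sign σ : ℤ) : ℂ) • colFermion T := by
  rw [colFermion, colOp, evalThetaTop_apply, extRep_prod_apply σ _ _
    (fun j : Fin k => offDiagSum opE (colBlock T j)), extRep_thetaTop, map_zsmul,
    Int.cast_smul_eq_zsmul]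
  intro j _ x
  have h2 := two_le_colLen_flagShape (n := n) hk j.2
  rw [← card_colBlock T j] at h2
  rw [coe_offDiagSum_opE (by omega), extRep_blockOp, map_colBlock_of_mem hσ]

open Classical in
theorem colAntisym_colFermion {n k : ℕ} {hk : 1 ≤ k} (T : Tableau n (flagShape n k hk)) :
    colAntisym (extRep n) T (colFermion T) =
      ((Finset.univ.filter fun σ => σ ∈ colGroup T).card : ℂ) • colFermion T := by
  rw [colAntisym, LinearMap.sum_apply, Finset.sum_congr rfl (g := fun _ => colFermion T),
    Finset.sum_const, Nat.cast_smul_eq_nsmul]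
  intro σ hσ
  rw [LinearMap.smul_apply, extRep_colFermion_of_mem T (Finset.mem_filter.1 hσ).2, smul_smul]
  norm_cast
  rw [Int.units_mul_self]
  simp

/-- The product of the operators `ξ_a · (θ_b ⊙ -)`, with `a` above `b` the first two entries of a
column, applied to `θ_1 ⋯ θ_n`. -/
def topMonomial {n k : ℕ} {hk : 1 ≤ k} (T : Tableau n (flagShape n k hk)) : Ext n :=
  evalThetaTop n (∏ j, opE (topEntry T j) (secondEntry T j))

/-- The column fermion is the sum, over choices `f` of an ordered pair in every column, of monomials
that are signed column translates of `topMonomial T`. All of them have the same antisymmetrization.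
Comparison with `colAntisym_colFermion` gives `c` as the order of the column group divided by the
number of choices. -/
theorem colAntisym_topMonomial {n k : ℕ} {hk : 1 ≤ k} (T : Tableau n (flagShape n k hk)) :
    ∃ c : ℂ, c ≠ 0 ∧ colAntisym (extRep n) T (topMonomial T) = c • colFermion T := by
  classical
  set F := Fintype.piFinset fun j : Fin k => (colBlock T j).offDiag with hF
  have hexp : colFermion T = ∑ f ∈ F, evalThetaTop n (∏ j, opE (f j).1 (f j).2) := by
    rw [colFermion, colOp]
    simp only [offDiagSum]
    rw [Finset.prod_univ_sum, map_sum]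
  have hterm : ∀ f ∈ F, colAntisym (extRep n) T (evalThetaTop n (∏ j, opE (f j).1 (f j).2)) =
      colAntisym (extRep n) T (topMonomial T) := by
    intro f hf
    obtain ⟨τ, hτ, hτf⟩ := exists_mem_colGroup T f fun j => Fintype.mem_piFinset.1 hf j
    have h := extRep_evalThetaTop_prod_opE τ (topEntry T) (secondEntry T)
    simp only [fun j => (hτf j).1, fun j => (hτf j).2] at h
    have h2 := colAntisym_apply_of_mem (extRep n) T hτ (topMonomial T)
    rw [topMonomial, h, map_smul] at h2
    refine smul_right_injective (Ext n) (r := ((Perm.sign τ : ℤ) : ℂ)) ?_ h2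
    rcases Int.units_eq_one_or (Perm.sign τ) with h | h <;> simp [h]
  have hFne : (F.card : ℂ) ≠ 0 := by
    rw [Nat.cast_ne_zero, ← Nat.pos_iff_ne_zero, Finset.card_pos]
    refine ⟨fun j => (topEntry T j, secondEntry T j), Fintype.mem_piFinset.2 fun j =>
      Finset.mem_offDiag.2 ⟨mem_colBlock.2 ?_, mem_colBlock.2 ?_, topEntry_ne_secondEntry T j j⟩⟩
    · rw [apply_topEntry]
    · rw [apply_secondEntry]
  have hGne : ((Finset.univ.filter fun σ => σ ∈ colGroup T).card : ℂ) ≠ 0 := by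
    rw [Nat.cast_ne_zero, ← Nat.pos_iff_ne_zero, Finset.card_pos]
    exact ⟨1, Finset.mem_filter.2 ⟨Finset.mem_univ _, one_mem_colGroup T⟩⟩
  have h := colAntisym_colFermion T
  nth_rw 1 [hexp] at h
  rw [map_sum, Finset.sum_congr rfl hterm, Finset.sum_const, ← Nat.cast_smul_eq_nsmul ℂ] at h
  refine ⟨_, mul_ne_zero (inv_ne_zero hFne) hGne, ?_⟩
  rw [mul_smul, ← h, inv_smul_smul₀ hFne]

/-! ### Products of generators -/

theorem gen_mul_self {n : ℕ} (a : Fin n ⊕ Fin n) : (gen a * gen a : Ext n) = 0 :=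
  ExteriorAlgebra.ι_sq_zero _

theorem commute_gen_mul_gen {n : ℕ} (a b c : Fin n ⊕ Fin n) :
    Commute (gen a * gen b : Ext n) (gen c) := by
  rw [Commute, SemiconjBy, mul_assoc, gen_mul_gen b c, mul_neg, ← mul_assoc, gen_mul_gen a c,
    neg_mul, neg_neg, mul_assoc]

theorem commute_theta_mul_xi {n : ℕ} (i j : Fin n) :
    Commute (theta i * xi i : Ext n) (theta j * xi j) :=
  (commute_gen_mul_gen _ _ _).mul_right (commute_gen_mul_gen _ _ _)

theorem theta_mul_xi_sq {n : ℕ} (i : Fin n) : (theta i * xi i * (theta i * xi i) : Ext n) = 0 := by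
  have h : Commute (theta i * xi i : Ext n) (theta i) := commute_gen_mul_gen _ _ _
  rw [← mul_assoc, h.eq, ← mul_assoc, theta, gen_mul_self, zero_mul, zero_mul]

theorem add_pow_succ_of_sq_eq_zero {R : Type*} [Ring R] {y s : R} (h : Commute y s)
    (hy : y * y = 0) (m : ℕ) : (y + s) ^ (m + 1) = s ^ (m + 1) + (m + 1 : ℕ) * (y * s ^ m) := by
  induction m with
  | zero => simp [add_comm]
  | succ m ih =>
    have h1 : s ^ (m + 1) * y = y * s ^ (m + 1) := (h.pow_right _).eq.symm
    have h2 : y * s ^ m * y = 0 := by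
      rw [mul_assoc, ← (h.pow_right m).eq, ← mul_assoc, hy, zero_mul]
    rw [pow_succ, ih, add_mul, mul_add, mul_add, h1, mul_assoc _ _ y, h2, mul_zero, zero_add,
      mul_assoc _ _ s, mul_assoc y, ← pow_succ, ← pow_succ]
    push_cast
    noncomm_ring

/-- Only squarefree terms of the multinomial expansion survive. The vanishing of the next power is
proved alongside, because it removes the term without `y` in the induction step. -/
theorem list_sum_pow_length {R : Type*} [Ring R] (L : List R)
    (hcomm : ∀ x ∈ L, ∀ y ∈ L, Commute x y) (hsq : ∀ x ∈ L, x * x = 0) :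
    L.sum ^ L.length = (L.length.factorial : R) * L.prod ∧ L.sum ^ (L.length + 1) = 0 := by
  induction L with
  | nil => simp
  | cons y L ih =>
    obtain ⟨h1, h2⟩ := ih (fun a ha b hb => hcomm a (List.mem_cons_of_mem _ ha) b
      (List.mem_cons_of_mem _ hb)) fun a ha => hsq a (List.mem_cons_of_mem _ ha)
    have hys : Commute y L.sum := Commute.list_sum_right y L fun x hx =>
      hcomm y List.mem_cons_self x (List.mem_cons_of_mem _ hx)
    have hy := hsq y List.mem_cons_self
    rw [List.sum_cons, List.length_cons, List.prod_cons, add_pow_succ_of_sq_eq_zero hys hy,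
      add_pow_succ_of_sq_eq_zero hys hy, pow_succ L.sum (L.length + 1), h2, h1]
    constructor
    · rw [zero_add, Nat.factorial_succ, Nat.cast_mul, mul_assoc, ← mul_assoc y,
        ← (Nat.cast_commute _ y).eq, mul_assoc]
    · simp

theorem prod_map_theta_perm {n : ℕ} {l l' : List (Fin n)} (h : l.Perm l') :
    ∃ c : ℂ, c ≠ 0 ∧ (l.map theta).prod = c • (l'.map theta).prod := by
  induction h with
  | nil => exact ⟨1, one_ne_zero, by simp⟩
  | cons x _ ih =>
    obtain ⟨c, hc, h⟩ := ih
    exact ⟨c, hc, by simp [h]⟩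
  | swap x y l =>
    refine ⟨-1, by simp, ?_⟩
    simp only [List.map_cons, List.prod_cons, ← mul_assoc]
    rw [theta, theta, gen_mul_gen, neg_mul, neg_smul, one_smul]
  | trans _ _ ih1 ih2 =>
    obtain ⟨c, hc, h⟩ := ih1
    obtain ⟨d, hd, h'⟩ := ih2
    exact ⟨c * d, mul_ne_zero hc hd, by rw [h, h', smul_smul]⟩

/-- A list of length at most `n` that meets every index is a reordering of all indices, so the two
products agree up to sign. -/
theorem thetaTop_eq_smul_of_forall_mem {n : ℕ} {l : List (Fin n)} (hmem : ∀ a, a ∈ l)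
    (hlen : l.length ≤ n) : ∃ c : ℂ, c ≠ 0 ∧ thetaTop n = c • (l.map theta).prod := by
  have hsub : (List.finRange n).Subperm l :=
    List.subperm_of_subset (List.nodup_finRange n) fun a _ => hmem a
  have hperm := hsub.perm_of_length_le (by simpa using hlen)
  rw [thetaTop, List.ofFn_eq_map]
  exact prod_map_theta_perm hperm

theorem contract_inl_theta_mul {n : ℕ} {b x : Fin n} (h : b ≠ x) (f : Ext n) :
    contract (Sum.inl b) (theta x * f) = -(theta x * contract (Sum.inl b) f) := by
  rw [theta, contract_gen_mul, if_neg (by simpa using h), zero_sub]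

theorem contract_inl_xi_mul {n : ℕ} (b x : Fin n) (f : Ext n) :
    contract (Sum.inl b) (xi x * f) = -(xi x * contract (Sum.inl b) f) := by
  rw [xi, contract_gen_mul, if_neg (by simp), zero_sub]

theorem contract_one {n : ℕ} (a : Fin n ⊕ Fin n) : contract a (1 : Ext n) = 0 := by
  simpa using contract_algebraMap a (1 : ℂ)

theorem contract_prod_map_theta {n : ℕ} {b : Fin n} {l : List (Fin n)} (h : b ∉ l) :
    contract (Sum.inl b) (l.map theta).prod = 0 := by
  induction l with
  | nil => exact contract_one _
  | cons x l ih =>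
    rw [List.mem_cons, not_or] at h
    rw [List.map_cons, List.prod_cons, contract_inl_theta_mul h.1, ih h.2, mul_zero, neg_zero]

theorem elemOp_theta_mul {n : ℕ} {i j x : Fin n} (h : j ≠ x) (f : Ext n) :
    elemOp i j (theta x * f) = theta x * elemOp i j f := by
  rw [elemOp_apply, contract_inl_theta_mul h, elemOp_apply, mul_neg, ← mul_assoc, theta,
    gen_mul_gen, neg_mul, neg_neg, mul_assoc]

theorem elemOp_theta_mul_theta_mul {n : ℕ} {a b : Fin n} (hab : a ≠ b) {f : Ext n}
    (hf : contract (Sum.inl b) f = 0) :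
    elemOp a b (theta a * (theta b * f)) = theta a * (xi a * f) := by
  rw [elemOp_theta_mul hab.symm, elemOp_apply, theta, theta, contract_gen_mul, if_pos rfl, hf,
    mul_zero, sub_zero]
  rfl

theorem contract_prod_theta_mul_xi {n : ℕ} {κ : Type*} {b : Fin n} (a : κ → Fin n) (J : List κ)
    (hb : ∀ j ∈ J, b ≠ a j) {f : Ext n} (hf : contract (Sum.inl b) f = 0) :
    contract (Sum.inl b) ((J.map fun j => theta (a j) * xi (a j)).prod * f) = 0 := by
  induction J with
  | nil => simpa using hf
  | cons j J ih =>
    rw [List.map_cons, List.prod_cons, mul_assoc, mul_assoc,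
      contract_inl_theta_mul (hb j List.mem_cons_self), contract_inl_xi_mul,
      ih fun i hi => hb i (List.mem_cons_of_mem _ hi)]
    simp

theorem prod_opE_theta_mul {n : ℕ} {κ : Type*} (a b : κ → Fin n) (J : List κ) {x : Fin n}
    (hx : ∀ j ∈ J, b j ≠ x) (f : Ext n) :
    ((J.map fun j => opE (a j) (b j)).prod : opAlg n).1 (theta x * f) =
      theta x * ((J.map fun j => opE (a j) (b j)).prod : opAlg n).1 f := by
  induction J with
  | nil => rfl
  | cons j J ih =>
    rw [List.map_cons, List.prod_cons]
    change elemOp (a j) (b j) (((J.map fun j => opE (a j) (b j)).prod : opAlg n).1 (theta x * f)) =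
      theta x * elemOp (a j) (b j) (((J.map fun j => opE (a j) (b j)).prod : opAlg n).1 f)
    rw [ih fun i hi => hx i (List.mem_cons_of_mem _ hi), elemOp_theta_mul (hx j List.mem_cons_self)]

/-- Each operator passes the pairs of the others, since the `b j` are distinct and differ from every
`a i`. On its own pair it turns `θ_a θ_b` into `θ_a ξ_a`. -/
theorem prod_opE_prod_theta {n : ℕ} {κ : Type*} {a b : κ → Fin n} (hb : Function.Injective b)
    (hab : ∀ i j, a i ≠ b j) {J : List κ} (hJ : J.Nodup) {f : Ext n}
    (hf : ∀ j ∈ J, contract (Sum.inl (b j)) f = 0) :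
    ((J.map fun j => opE (a j) (b j)).prod : opAlg n).1
        (((J.flatMap fun j => [a j, b j]).map theta).prod * f) =
      (J.map fun j => theta (a j) * xi (a j)).prod * f := by
  induction J with
  | nil => simp
  | cons j J ih =>
    rw [List.nodup_cons] at hJ
    have hne : ∀ i ∈ J, b i ≠ b j := fun i hi h => hJ.1 (hb h ▸ hi)
    rw [List.map_cons, List.prod_cons]
    change elemOp (a j) (b j) (((J.map fun j => opE (a j) (b j)).prod : opAlg n).1 _) = _
    simp only [List.flatMap_cons, List.cons_append, List.nil_append, List.map_cons,
      List.prod_cons, mul_assoc]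
    rw [prod_opE_theta_mul a b J fun i _ => (hab j i).symm, prod_opE_theta_mul a b J hne,
      ih hJ.2 fun i hi => hf i (List.mem_cons_of_mem _ hi),
      elemOp_theta_mul_theta_mul (hab j j)]
    exact contract_prod_theta_mul_xi a J (fun i _ => (hab i j).symm) (hf j List.mem_cons_self)

/-! ### The map from tabloids to the exterior algebra -/

/-- The monomial attached to a row function `r`: the `θ_i ξ_i` for `i` in row `0`, nothing for
row `1`, and `θ_i` for `i` in the rows from row `2` on. -/
def tabloidMonomial (n k : ℕ) (r : Fin n → ℕ) : Ext n :=
  (∑ i with r i = 0, theta i * xi i) ^ k *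
    ((List.finRange (n - 2 * k)).map fun t : Fin (n - 2 * k) =>
      ∑ i with r i = (t : ℕ) + 2, theta i).prod

/-- The linear extension of `tabloidMonomial`. -/
def tabloidMap (n k : ℕ) : ((Fin n → ℕ) →₀ ℂ) →ₗ[ℂ] Ext n :=
  Finsupp.linearCombination ℂ (tabloidMonomial n k)

theorem sum_filter_comp_perm {n : ℕ} {M : Type*} [AddCommMonoid M] (w : Perm (Fin n))
    (r : Fin n → ℕ) (t : ℕ) (g : Fin n → M) :
    ∑ i with r i = t, g (w i) = ∑ i with (r ∘ (w⁻¹ : Perm (Fin n))) i = t, g i := by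
  rw [Finset.sum_filter, Finset.sum_filter,
    ← Equiv.sum_comp w fun i => if (r ∘ (w⁻¹ : Perm (Fin n))) i = t then g i else 0]
  simp

/-- No sign appears, because the factors are ordered by row number rather than by entry. -/
theorem extRep_tabloidMonomial {n k : ℕ} (w : Perm (Fin n)) (r : Fin n → ℕ) :
    extRep n w (tabloidMonomial n k r) = tabloidMonomial n k (r ∘ (w⁻¹ : Perm (Fin n))) := by
  have h1 (i : Fin n) : extRep n w (theta i) = theta (w i) := extRep_gen w _
  have h2 (i : Fin n) : extRep n w (xi i) = xi (w i) := extRep_gen w _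
  rw [tabloidMonomial, tabloidMonomial, extRep_mul]
  congr 1
  · rw [extRep_apply, map_pow, ← extRep_apply, map_sum]
    simp only [extRep_mul, h1, h2]
    rw [sum_filter_comp_perm w r 0 fun i => theta i * xi i]
  · rw [extRep_apply, map_list_prod, List.map_map]
    congr 1
    refine List.map_congr_left fun t _ => ?_
    rw [Function.comp_apply, ← extRep_apply, map_sum]
    simp only [h1]
    exact sum_filter_comp_perm w r _ theta

theorem tabloidMap_tabloidRep {n k : ℕ} (w : Perm (Fin n)) (x : (Fin n → ℕ) →₀ ℂ) :
    tabloidMap n k (tabloidRep n w x) = extRep n w (tabloidMap n k x) := by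
  induction x using Finsupp.induction_linear with
  | zero => simp
  | add x y hx hy => simp only [map_add, hx, hy]
  | single r c =>
    rw [tabloidRep_single, tabloidMap, Finsupp.linearCombination_single,
      Finsupp.linearCombination_single, map_smul, extRep_tabloidMonomial]

/-- The entry of a flag-shaped tableau in row `t + 2`. -/
def legEntry {n k : ℕ} {hk : 1 ≤ k} (T : Tableau n (flagShape n k hk)) (t : Fin (n - 2 * k)) :
    Fin n :=
  T.symm ⟨(t + 2, 0), mem_flagShape.2 (Or.inr ⟨by omega, by omega, rfl⟩)⟩

theorem apply_legEntry {n k : ℕ} {hk : 1 ≤ k} (T : Tableau n (flagShape n k hk))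
    (t : Fin (n - 2 * k)) : (T (legEntry T t)).1 = ((t : ℕ) + 2, 0) := by
  simp [legEntry]

theorem entry_cases {n k : ℕ} {hk : 1 ≤ k} (T : Tableau n (flagShape n k hk)) (a : Fin n) :
    (∃ j, a = topEntry T j) ∨ (∃ j, a = secondEntry T j) ∨ ∃ t, a = legEntry T t := by
  have h : ((T a).1.1, (T a).1.2) ∈ flagShape n k hk := (T a).2
  rw [mem_flagShape] at h
  rcases h with ⟨h1, h2⟩ | ⟨h1, h2, h3⟩
  · rcases (show (T a).1.1 = 0 ∨ (T a).1.1 = 1 by omega) with h0 | h0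
    · exact Or.inl ⟨⟨_, h2⟩, T.injective (Subtype.ext
        (by rw [apply_topEntry]; exact Prod.ext h0 rfl))⟩
    · exact Or.inr (Or.inl ⟨⟨_, h2⟩, T.injective (Subtype.ext
        (by rw [apply_secondEntry]; exact Prod.ext h0 rfl))⟩)
  · exact Or.inr (Or.inr ⟨⟨(T a).1.1 - 2, by omega⟩, T.injective (Subtype.ext
      (by rw [apply_legEntry]; exact Prod.ext (by simp only; omega) h3))⟩)

theorem legEntry_ne_secondEntry {n k : ℕ} {hk : 1 ≤ k} (T : Tableau n (flagShape n k hk))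
    (t : Fin (n - 2 * k)) (j : Fin k) : legEntry T t ≠ secondEntry T j := fun h => by
  have h1 := apply_legEntry T t
  rw [h, apply_secondEntry] at h1
  have := (Prod.mk.inj h1).1
  omega

/-- Row `0` contributes `k` commuting elements of square zero, so the `k`-th power of their sum is
`k!` times their product. Every row from `2` on has a single entry. -/
theorem tabloidMonomial_tabloid {n k : ℕ} {hk : 1 ≤ k} (T : Tableau n (flagShape n k hk)) :
    tabloidMonomial n k (tabloid T) = (k.factorial : ℂ) •
      (((List.finRange k).map fun j => theta (topEntry T j) * xi (topEntry T j)).prod *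
        (((List.finRange (n - 2 * k)).map (legEntry T)).map theta).prod) := by
  have htop : ∑ i with tabloid T i = 0, theta i * xi i =
      ((List.finRange k).map fun j => theta (topEntry T j) * xi (topEntry T j)).sum := by
    rw [← List.ofFn_eq_map, List.sum_ofFn]
    refine (Finset.sum_bij (fun j _ => topEntry T j) ?_ ?_ ?_ ?_).symm
    · intro j _
      exact Finset.mem_filter.2 ⟨Finset.mem_univ _, congrArg Prod.fst (apply_topEntry T j)⟩
    · intro i _ j _ h
      exact topEntry_injective T h
    · intro a ha
      have h0 : (T a).1.1 = 0 := (Finset.mem_filter.1 ha).2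
      exact ⟨⟨_, col_lt T a⟩, Finset.mem_univ _, T.injective (Subtype.ext
        (by rw [apply_topEntry]; exact Prod.ext h0.symm rfl))⟩
    · intro j _
      rfl
  have hleg (t : Fin (n - 2 * k)) : ∑ i with tabloid T i = t + 2, theta i =
      (theta (legEntry T t) : Ext n) := by
    rw [show (Finset.univ.filter fun i => tabloid T i = t + 2) = {legEntry T t} from ?_,
      Finset.sum_singleton]
    ext a
    simp only [Finset.mem_filter, Finset.mem_univ, true_and, Finset.mem_singleton]
    constructor
    · intro h
      change (T a).1.1 = _ at h
      have hm : ((T a).1.1, (T a).1.2) ∈ flagShape n k hk := (T a).2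
      rw [mem_flagShape] at hm
      refine T.injective (Subtype.ext ?_)
      rw [apply_legEntry]
      exact Prod.ext h (by simp only; omega)
    · rintro rfl
      change (T _).1.1 = _
      rw [apply_legEntry]
  have hpow := (list_sum_pow_length
    ((List.finRange k).map fun j => (theta (topEntry T j) * xi (topEntry T j) : Ext n))
    (by
      intro x hx y hy
      obtain ⟨i, -, rfl⟩ := List.mem_map.1 hx
      obtain ⟨j, -, rfl⟩ := List.mem_map.1 hy
      exact commute_theta_mul_xi _ _)
    (by
      intro x hx
      obtain ⟨i, -, rfl⟩ := List.mem_map.1 hx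
      exact theta_mul_xi_sq _)).1
  rw [List.length_map, List.length_finRange] at hpow
  rw [tabloidMonomial, htop, hpow, List.map_map]
  simp only [hleg]
  rw [Algebra.smul_def, map_natCast, mul_assoc]
  rfl

theorem topMonomial_eq_smul {n k : ℕ} {hk : 1 ≤ k} (hkn : 2 * k ≤ n)
    (T : Tableau n (flagShape n k hk)) :
    ∃ c : ℂ, c ≠ 0 ∧ tabloidMonomial n k (tabloid T) = c • topMonomial T := by
  -- The variables `θ` are listed pair by pair along the columns, followed by the leg, so that each
  -- operator meets its own two variables side by side.
  set L := ((List.finRange k).flatMap fun j => [topEntry T j, secondEntry T j]) ++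
    (List.finRange (n - 2 * k)).map (legEntry T) with hL
  obtain ⟨c, hc, h⟩ := thetaTop_eq_smul_of_forall_mem (l := L)
    (by
      intro a
      rw [hL, List.mem_append, List.mem_flatMap]
      rcases entry_cases T a with ⟨j, rfl⟩ | ⟨j, rfl⟩ | ⟨t, rfl⟩
      · exact Or.inl ⟨j, List.mem_finRange j, by simp⟩
      · exact Or.inl ⟨j, List.mem_finRange j, by simp⟩
      · exact Or.inr (List.mem_map_of_mem (List.mem_finRange t)))
    (by simp [hL]; omega)
  have hm : topMonomial T = c •
      (((List.finRange k).map fun j => theta (topEntry T j) * xi (topEntry T j)).prod *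
        (((List.finRange (n - 2 * k)).map (legEntry T)).map theta).prod) := by
    rw [topMonomial, evalThetaTop_apply, h, map_smul, ← List.prod_ofFn, List.ofFn_eq_map, hL,
      List.map_append, List.prod_append, prod_opE_prod_theta (secondEntry_injective T)
        (topEntry_ne_secondEntry T) (List.nodup_finRange k)]
    intro j _
    refine contract_prod_map_theta fun hmem => ?_
    obtain ⟨t, -, ht⟩ := List.mem_map.1 hmem
    exact legEntry_ne_secondEntry T t j ht
  refine ⟨k.factorial * c⁻¹, mul_ne_zero (Nat.cast_ne_zero.2 k.factorial_ne_zero)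
    (inv_ne_zero hc), ?_⟩
  rw [tabloidMonomial_tabloid, hm, mul_smul, inv_smul_smul₀ hc]

theorem tabloidMap_polytabloid {n k : ℕ} {hk : 1 ≤ k} (hkn : 2 * k ≤ n)
    (T : Tableau n (flagShape n k hk)) :
    ∃ c : ℂ, c ≠ 0 ∧ tabloidMap n k (polytabloid T) = c • colFermion T := by
  obtain ⟨c, hc, h⟩ := topMonomial_eq_smul hkn T
  obtain ⟨d, hd, h'⟩ := colAntisym_topMonomial T
  refine ⟨c * d, mul_ne_zero hc hd, ?_⟩
  rw [← colAntisym_single_tabloid, colAntisym_map _ _ _ tabloidMap_tabloidRep, tabloidMap,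
    Finsupp.linearCombination_single, one_smul, h, map_smul, h', smul_smul]

/-! ### Nonvanishing of the contracted fermions -/

theorem contract_inr_elemOp {n : ℕ} (a i j : Fin n) (f : Ext n) :
    contract (Sum.inr a) (elemOp i j f) =
      (if a = i then contract (Sum.inl j) f else 0) + elemOp i j (contract (Sum.inr a) f) := by
  rw [elemOp_apply, contract_gen_mul, contract_comm (Sum.inr a), mul_neg, sub_neg_eq_add,
    elemOp_apply]
  simp only [Sum.inr.injEq]

theorem commute_contract_opE {n : ℕ} {a i : Fin n} (h : a ≠ i) (j : Fin n) :
    Commute (contract (Sum.inr a)) (opE i j).1 :=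
  LinearMap.ext fun f => by
    change contract (Sum.inr a) (elemOp i j f) = elemOp i j (contract (Sum.inr a) f)
    rw [contract_inr_elemOp, if_neg h, zero_add]

theorem commute_contract_offDiagSum {n : ℕ} {a : Fin n} {B : Finset (Fin n)} (h : a ∉ B) :
    Commute (contract (Sum.inr a)) (offDiagSum opE B).1 := by
  have hval : (offDiagSum opE B).1 = ∑ p ∈ B.offDiag, (opE p.1 p.2).1 :=
    map_sum (opAlg n).val _ _
  rw [hval]
  exact Commute.sum_right _ _ _ fun p hp =>
    commute_contract_opE (ne_of_mem_of_not_mem (Finset.mem_offDiag.1 hp).1 h).symm _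

theorem xiDeriv_contract {n : ℕ} (a : Fin n) (f : Ext n) :
    xiDeriv n (contract (Sum.inr a) f) = -contract (Sum.inr a) (xiDeriv n f) := by
  simp only [xiDeriv, LinearMap.sum_apply, map_sum, ← Finset.sum_neg_distrib]
  exact Finset.sum_congr rfl fun i _ => contract_comm _ _ _

theorem xiDeriv_elemOp {n : ℕ} (i j : Fin n) {f : Ext n}
    (hf : ∀ a, contract (Sum.inr a) f = 0) : xiDeriv n (elemOp i j f) = contract (Sum.inl j) f := by
  simp [xiDeriv, LinearMap.sum_apply, contract_inr_elemOp, hf]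

/-- For fixed `j`, the contraction by `θ_j` appears once for every other element `i` of `B`. -/
theorem xiDeriv_offDiagSum {n : ℕ} (B : Finset (Fin n)) {f : Ext n}
    (hf : ∀ a, contract (Sum.inr a) f = 0) :
    xiDeriv n ((offDiagSum opE B).1 f) =
      ((B.card - 1 : ℕ) : ℂ) • ∑ j ∈ B, contract (Sum.inl j) f := by
  have hval : (offDiagSum opE B).1 f = ∑ p ∈ B.offDiag, elemOp p.1 p.2 f := by
    rw [offDiagSum, ← LinearMap.sum_apply]
    exact congrArg (fun x : Module.End ℂ (Ext n) => x f) (map_sum (opAlg n).val _ _)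
  have hoff : B.offDiag = (B ×ˢ B).filter fun p => p.1 ≠ p.2 := by ext; simp [and_assoc]
  rw [hval, map_sum]
  simp only [xiDeriv_elemOp _ _ hf]
  rw [hoff, Finset.sum_filter, Finset.sum_product_right, Finset.smul_sum]
  refine Finset.sum_congr rfl fun j hj => ?_
  rw [← Finset.sum_filter]
  simp only
  rw [Finset.sum_const, Nat.cast_smul_eq_nsmul]
  congr 1
  rw [← Finset.card_erase_of_mem hj]
  congr 1
  ext i
  simp [and_comm]

/-- Contraction by `ξ_{a_j}` anticommutes with `xiDeriv`, commutes with the operators of the other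
blocks, and turns the pair operator of `j` into contraction by `θ_{b_j}`. Vanishing is therefore
inherited when the pairs are stripped off one at a time. -/
theorem xiDeriv_foldl_contract_eq_zero {n : ℕ} {κ : Type*} {a b : κ → Fin n}
    (ha : Function.Injective a) (hab : ∀ i j, a i ≠ b j) {B : Finset (Fin n)}
    (hB : ∀ j, a j ∉ B) {J : List κ} (hJ : J.Nodup) {f : Ext n}
    (hf : ∀ i, contract (Sum.inr i) f = 0)
    (h : xiDeriv n ((offDiagSum opE B *
      (J.map fun j => opE (a j) (b j) + opE (b j) (a j)).prod : opAlg n).1 f) = 0) :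
    xiDeriv n ((offDiagSum opE B).1 (J.foldl (fun x j => contract (Sum.inl (b j)) x) f)) = 0 ∧
      ∀ i, contract (Sum.inr i) (J.foldl (fun x j => contract (Sum.inl (b j)) x) f) = 0 := by
  induction J generalizing f with
  | nil =>
    rw [List.map_nil, List.prod_nil, mul_one] at h
    exact ⟨h, hf⟩
  | cons j J ih =>
    rw [List.nodup_cons] at hJ
    rw [List.foldl_cons]
    set Q : opAlg n := offDiagSum opE B * (J.map fun j => opE (a j) (b j) + opE (b j) (a j)).prod
      with hQ
    have hcomm : Commute (contract (Sum.inr (a j))) Q.1 := by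
      refine (commute_contract_offDiagSum (hB j)).mul_right ?_
      have hval : ((J.map fun j => opE (a j) (b j) + opE (b j) (a j)).prod : opAlg n).1 =
          (J.map fun j => (opE (a j) (b j)).1 + (opE (b j) (a j)).1).prod := by
        refine (map_list_prod (opAlg n).val _).trans ?_
        rw [List.map_map]
        rfl
      rw [hval]
      refine Commute.list_prod_right _ _ fun x hx => ?_
      obtain ⟨i, hi, rfl⟩ := List.mem_map.1 hx
      exact (commute_contract_opE (ha.ne (ne_of_mem_of_not_mem hi hJ.1).symm) _).add_right
        (commute_contract_opE (hab j i) _)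
    refine ih hJ.2 (fun i => by rw [contract_comm, hf, map_zero, neg_zero]) ?_
    -- The factor of `j` is moved to act on `f` first.
    rw [List.map_cons, List.prod_cons, mul_left_comm, ← hQ, mul_comm] at h
    have h1 := congrArg (contract (Sum.inr (a j))) h
    rw [map_zero, ← neg_eq_zero, ← xiDeriv_contract] at h1
    have h2 : contract (Sum.inr (a j)) ((Q * (opE (a j) (b j) + opE (b j) (a j))).1 f) =
        Q.1 (contract (Sum.inl (b j)) f) := by
      have h3 : contract (Sum.inr (a j)) (elemOp (a j) (b j) f + elemOp (b j) (a j) f) =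
          contract (Sum.inl (b j)) f := by
        rw [map_add, contract_inr_elemOp, contract_inr_elemOp, if_pos rfl, if_neg (hab j j), hf]
        simp
      rw [← h3]
      exact LinearMap.congr_fun hcomm.eq _
    rwa [h2] at h1

theorem foldl_contract_prod_theta {n : ℕ} {κ : Type*} {b : κ → Fin n}
    (hb : Function.Injective b) {J : List κ} (hJ : J.Nodup) {f : Ext n}
    (hf : ∀ j ∈ J, contract (Sum.inl (b j)) f = 0) :
    J.foldl (fun x j => contract (Sum.inl (b j)) x) (((J.map b).map theta).prod * f) = f := by
  induction J with
  | nil => simp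
  | cons j J ih =>
    rw [List.nodup_cons] at hJ
    have hz : contract (Sum.inl (b j)) (((J.map b).map theta).prod * f) = 0 := by
      have hj : ∀ i ∈ J, b j ≠ b i := fun i hi h => hJ.1 (hb h ▸ hi)
      clear ih hJ
      induction J with
      | nil => simpa using hf j List.mem_cons_self
      | cons i J ih =>
        rw [List.map_cons, List.map_cons, List.prod_cons, mul_assoc,
          contract_inl_theta_mul (hj i List.mem_cons_self),
          ih (fun l hl => hf l (by
            rcases List.mem_cons.1 hl with rfl | hl
            · exact List.mem_cons_self
            · exact List.mem_cons_of_mem _ (List.mem_cons_of_mem _ hl)))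
            fun l hl => hj l (List.mem_cons_of_mem _ hl), mul_zero, neg_zero]
    rw [List.map_cons, List.map_cons, List.prod_cons, List.foldl_cons, mul_assoc, theta,
      contract_gen_mul, if_pos rfl, hz, mul_zero, sub_zero]
    exact ih hJ.2 fun i hi => hf i (List.mem_cons_of_mem _ hi)

theorem prod_map_theta_ne_zero {n : ℕ} {l : List (Fin n)} (hl : l.Nodup) :
    ((l.map theta).prod : Ext n) ≠ 0 := by
  induction l with
  | nil => simp
  | cons x l ih =>
    rw [List.nodup_cons] at hl
    intro h
    refine ih hl.2 ?_
    have := congrArg (contract (Sum.inl x)) h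
    rwa [List.map_cons, List.prod_cons, theta, contract_gen_mul, if_pos rfl, map_zero,
      contract_prod_map_theta hl.1, mul_zero, sub_zero] at this

theorem contract_inr_prod_map_theta {n : ℕ} (i : Fin n) (l : List (Fin n)) :
    contract (Sum.inr i) ((l.map theta).prod : Ext n) = 0 := by
  induction l with
  | nil => exact contract_one _
  | cons x l ih =>
    rw [List.map_cons, List.prod_cons, theta, contract_gen_mul, if_neg (by simp), ih, mul_zero,
      sub_zero]

/-- With `D` the sum of contractions and `p` the product over `l`, one has `D (θ_x p) = p - θ_x D
p`. If this were zero, then `θ_x p = θ_x θ_x D p = 0`. -/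
theorem sum_contract_prod_map_theta_ne_zero {n : ℕ} {B : Finset (Fin n)} {x : Fin n}
    {l : List (Fin n)} (hx : x ∈ B) (hl : (x :: l).Nodup) :
    ∑ j ∈ B, contract (Sum.inl j) (((x :: l).map theta).prod : Ext n) ≠ 0 := fun h => by
  classical
  refine prod_map_theta_ne_zero hl ?_
  simp only [List.map_cons, List.prod_cons] at h ⊢
  have h1 (j : Fin n) : contract (Sum.inl j) (theta x * (l.map theta).prod : Ext n) =
      (if j = x then (l.map theta).prod else 0) -
        theta x * contract (Sum.inl j) (l.map theta).prod := by
    rw [theta, contract_gen_mul]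
    simp only [Sum.inl.injEq]
  simp only [h1, Finset.sum_sub_distrib, ← Finset.mul_sum] at h
  rw [Finset.sum_ite_eq' B x, if_pos hx, sub_eq_zero] at h
  rw [h, ← mul_assoc, theta, gen_mul_self, zero_mul]

theorem colBlock_of_ne_zero {n k : ℕ} {hk : 1 ≤ k} (T : Tableau n (flagShape n k hk)) {j : Fin k}
    (hj : (j : ℕ) ≠ 0) : colBlock T j = {topEntry T j, secondEntry T j} := by
  symm
  refine Finset.eq_of_subset_of_card_le ?_ ?_
  · intro a ha
    rw [mem_colBlock]
    rcases Finset.mem_insert.1 ha with rfl | ha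
    · rw [apply_topEntry]
    · rw [Finset.mem_singleton.1 ha, apply_secondEntry]
  · rw [card_colBlock, colLen_flagShape_of_ne_zero hk hj j.2,
      Finset.card_pair (topEntry_ne_secondEntry T j j)]

theorem xiDeriv_colFermion_ne_zero {n k : ℕ} {hk : 1 ≤ k} (T : Tableau n (flagShape n k hk)) :
    xiDeriv n (colFermion T) ≠ 0 := by
  classical
  obtain ⟨k, rfl⟩ : ∃ l, k = l + 1 := ⟨k - 1, by omega⟩
  intro h
  let a : Fin k → Fin n := fun j => topEntry T j.succ
  let b : Fin k → Fin n := fun j => secondEntry T j.succ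
  have hb : Function.Injective b := (secondEntry_injective T).comp (Fin.succ_injective _)
  have hab : ∀ i j, a i ≠ b j := fun i j => topEntry_ne_secondEntry T _ _
  have hop : colOp T = offDiagSum opE (colBlock T 0) *
      ((List.finRange k).map fun j => opE (a j) (b j) + opE (b j) (a j)).prod := by
    rw [colOp, Fin.prod_univ_succ, ← List.ofFn_eq_map, List.prod_ofFn]
    refine congrArg _ (Finset.prod_congr rfl fun j _ => ?_)
    rw [colBlock_of_ne_zero T (by simp), offDiagSum_pair _ (hab j j)]
  -- The lower entries `b j` of the pair columns come first, to be removed by the contractions. Then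
  -- comes `x`, which lies in column `0`, as the last nonvanishing step requires.
  set x := topEntry T 0 with hx
  set M := (Finset.univ.filter fun i => (∀ j, i ≠ b j) ∧ i ≠ x).toList with hM
  have hMmem (i : Fin n) : i ∈ M ↔ (∀ j, i ≠ b j) ∧ i ≠ x := by simp [hM]
  have hxM : (x :: M).Nodup :=
    List.nodup_cons.2 ⟨fun h => ((hMmem x).1 h).2 rfl, Finset.nodup_toList _⟩
  have hbM (j : Fin k) : b j ∉ x :: M := by
    rw [List.mem_cons, hMmem]
    rintro (h | h)
    · exact topEntry_ne_secondEntry T _ _ h.symm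
    · exact h.1 j rfl
  have hnodup : (((List.finRange k).map b) ++ x :: M).Nodup := by
    refine List.Nodup.append ((List.nodup_finRange k).map hb) hxM ?_
    intro i hi hi'
    obtain ⟨j, -, rfl⟩ := List.mem_map.1 hi
    exact hbM j hi'
  obtain ⟨c, hc, htop⟩ := thetaTop_eq_smul_of_forall_mem
    (l := ((List.finRange k).map b) ++ x :: M)
    (by
      intro i
      rw [List.mem_append, List.mem_cons, hMmem]
      by_cases hi : ∃ j, i = b j
      · obtain ⟨j, rfl⟩ := hi
        exact Or.inl (List.mem_map_of_mem (List.mem_finRange j))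
      · push Not at hi
        tauto)
    (by simpa using hnodup.length_le_card)
  rw [colFermion, evalThetaTop_apply, htop, map_smul, map_smul, smul_eq_zero_iff_right hc, hop] at h
  obtain ⟨h1, h2⟩ := xiDeriv_foldl_contract_eq_zero
    ((topEntry_injective T).comp (Fin.succ_injective _)) hab
    (fun j hj => by
      rw [mem_colBlock, Function.comp_apply, apply_topEntry] at hj
      simp at hj) (List.nodup_finRange k)
    (fun i => contract_inr_prod_map_theta i _) h
  rw [xiDeriv_offDiagSum _ h2, List.map_append, List.prod_append,
    foldl_contract_prod_theta hb (List.nodup_finRange k)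
      fun j _ => contract_prod_map_theta (hbM j)] at h1
  refine sum_contract_prod_map_theta_ne_zero ?_ hxM ((smul_eq_zero.1 h1).resolve_left ?_)
  · rw [mem_colBlock, hx, apply_topEntry]
    rfl
  · rw [card_colBlock, colLen_flagShape_zero]
    -- Column `0` has at least two entries, so the factor `card - 1` is positive.
    exact Nat.cast_ne_zero.2 (by omega)

/-! ### The isomorphisms -/

theorem span_range_smul {ι M : Type*} [AddCommGroup M] [Module ℂ M] {u v : ι → M}
    (h : ∀ i, ∃ c : ℂ, c ≠ 0 ∧ u i = c • v i) :
    Submodule.span ℂ (Set.range u) = Submodule.span ℂ (Set.range v) := by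
  refine le_antisymm (Submodule.span_le.2 ?_) (Submodule.span_le.2 ?_)
  · rintro _ ⟨i, rfl⟩
    obtain ⟨c, -, hi⟩ := h i
    rw [hi]
    exact Submodule.smul_mem _ _ (Submodule.subset_span ⟨i, rfl⟩)
  · rintro _ ⟨i, rfl⟩
    obtain ⟨c, hc, hi⟩ := h i
    rw [← inv_smul_smul₀ hc (v i), ← hi]
    exact Submodule.smul_mem _ _ (Submodule.subset_span ⟨i, rfl⟩)

theorem W_toSubmodule {n k : ℕ} (hk : 1 ≤ k) (hkn : 2 * k ≤ n) :
    (W n k 0).toSubmodule = Submodule.span ℂ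
      (Set.range fun T : Tableau n (flagShape n k hk) => tabloidMap n k (polytabloid T)) :=
  (span_fermionF_partSet hk hkn).trans (span_range_smul (tabloidMap_polytabloid hkn)).symm

theorem V_toSubmodule {n k : ℕ} (hk : 1 ≤ k) (hkn : 2 * k ≤ n) :
    (V n k 0).toSubmodule = Submodule.span ℂ (Set.range fun T : Tableau n (flagShape n k hk) =>
      (xiDeriv n ∘ₗ tabloidMap n k) (polytabloid T)) := by
  have h : (V n k 0).toSubmodule = (W n k 0).toSubmodule.map (xiDeriv n) := by
    rw [V, W, Submodule.map_span, ← Set.image_comp]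
    rfl
  rw [h, W_toSubmodule hk hkn, Submodule.map_span, ← Set.range_comp]
  rfl

end

end SkeinFermion

theorem proposition5p3 (n k : ℕ) (hk : 1 ≤ k) (hkn : 2 * k ≤ n) :
    Representation.IsIrreducible
      (V := (SkeinFermion.specht n (SkeinFermion.flagShape n k hk)).toSubmodule)
      (SkeinFermion.specht n (SkeinFermion.flagShape n k hk)).toRepresentation ∧
    Nonempty ((SkeinFermion.W n k 0).toRepresentation.Equiv
      (SkeinFermion.specht n (SkeinFermion.flagShape n k hk)).toRepresentation) ∧
    Nonempty ((SkeinFermion.V n k 0).toRepresentation.Equiv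
      (SkeinFermion.specht n (SkeinFermion.flagShape n k hk)).toRepresentation) := by
  obtain ⟨T⟩ := SkeinFermion.exists_tableau_flagShape hk hkn
  obtain ⟨c, hc, h⟩ := SkeinFermion.tabloidMap_polytabloid hkn T
  have hV : (SkeinFermion.xiDeriv n ∘ₗ SkeinFermion.tabloidMap n k)
      (SkeinFermion.polytabloid T) ≠ 0 := by
    rw [LinearMap.comp_apply, h, map_smul]
    exact smul_ne_zero hc (SkeinFermion.xiDeriv_colFermion_ne_zero T)
  -- Nonvanishing after contraction implies nonvanishing before it.
  have hW : SkeinFermion.tabloidMap n k (SkeinFermion.polytabloid T) ≠ 0 := fun h0 =>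
    hV (by rw [LinearMap.comp_apply, h0, map_zero])
  refine ⟨SkeinFermion.specht_isIrreducible T fun h0 => hW (by rw [h0, map_zero]),
    SkeinFermion.specht_equiv_of_map _ SkeinFermion.tabloidMap_tabloidRep hW _
      (SkeinFermion.W_toSubmodule hk hkn),
    SkeinFermion.specht_equiv_of_map _ (fun w x => ?_) hV _ (SkeinFermion.V_toSubmodule hk hkn)⟩
  rw [LinearMap.comp_apply, LinearMap.comp_apply, SkeinFermion.tabloidMap_tabloidRep,
    SkeinFermion.extRep_xiDeriv]
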